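/- Let $X$ be a real Banach space, with dual $X^*$. Call a sequence $(u_n)_n$ Cesàro convergent to $u$ in a topology if its arithmetic means $\frac1k\sum_{n=1}^k u_n$ converge to $u$ in that topology. A Banach space $E$ has the Banach--Saks property if every sequence in its closed unit ball admits a subsequence which is Cesàro convergent in norm to some element of $E$. The Mackey topology $\mu(X^*,X)$ is the topology on $X^*$ of uniform convergence on all weakly compact subsets of $X$. The space $X$ has property $(\mu^s)$ if every weak$^*$-null sequence in $X^*$ admits a subsequence such that all of its subsequences are Cesàro convergent to $0$ with respect to $\mu(X^*,X)$. Then the following statements are equivalent: (i) $X^*$ has the Banach--Saks property; (ii) $X$ is reflexive and has property $(\mu^s)$; (iii) $X$ contains no closed linear subspace isomorphic (linearly homeomorphic) to $\ell^1$ and has property $(\mu^s)$. -/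

import Mathlib

open Filter Topology

noncomputable section

/-- The sequence `u` is Cesàro convergent to `l`: the arithmetic means of its first `n` terms
converge to `l`. -/
def CesaroTendsto {E : Type*} [AddCommMonoid E] [Module ℝ E] [TopologicalSpace E]
    (u : ℕ → E) (l : E) : Prop :=
  Tendsto (fun n : ℕ => (n : ℝ)⁻¹ • ∑ i ∈ Finset.range n, u i) atTop (𝓝 l)

/-- A set `C` is Banach-Saks if every sequence in `C` has a subsequence which is
Cesàro convergent in norm to some element of the space. -/
def IsBanachSaksSet {E : Type*} [NormedAddCommGroup E] [NormedSpace ℝ E] (C : Set E) : Prop :=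
  ∀ u : ℕ → E, (∀ n, u n ∈ C) →
    ∃ φ : ℕ → ℕ, StrictMono φ ∧ ∃ l : E, CesaroTendsto (fun n => u (φ n)) l

/-- The Banach-Saks property: the closed unit ball is a Banach-Saks set. -/
def HasBanachSaksProperty (E : Type*) [NormedAddCommGroup E] [NormedSpace ℝ E] : Prop :=
  IsBanachSaksSet (Metric.closedBall (0 : E) 1)

/-- The family of all weakly compact subsets of `X`. -/
def weaklyCompactSets (X : Type*) [NormedAddCommGroup X] [NormedSpace ℝ X] : Set (Set X) :=
  {K | IsCompact (toWeakSpace ℝ X '' K)}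

/-- The dual `X*` with the Mackey topology `μ(X*, X)`: the topology of uniform convergence on all
weakly compact subsets of `X`. -/
abbrev MackeyDual (X : Type*) [NormedAddCommGroup X] [NormedSpace ℝ X] : Type _ :=
  UniformConvergenceCLM (RingHom.id ℝ) (E := X) ℝ (weaklyCompactSets X)

/-- The identity map from `X*` to `X*` with its Mackey topology. -/
def toMackeyDual {X : Type*} [NormedAddCommGroup X] [NormedSpace ℝ X] :
    StrongDual ℝ X ≃ MackeyDual X :=
  UniformConvergenceCLM.ofFun (RingHom.id ℝ) ℝ (weaklyCompactSets X)

/-- Property `(μ^s)`: every weak*-null sequence in `X*` has a subsequence all of whose subsequences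
are Cesàro convergent to `0` in the Mackey topology. -/
def HasPropertyMuS (X : Type*) [NormedAddCommGroup X] [NormedSpace ℝ X] : Prop :=
  ∀ f : ℕ → StrongDual ℝ X,
    Tendsto (fun n => StrongDual.toWeakDual (f n)) atTop (𝓝 (0 : WeakDual ℝ X)) →
    ∃ φ : ℕ → ℕ, StrictMono φ ∧ ∀ ψ : ℕ → ℕ, StrictMono ψ →
      CesaroTendsto (fun n => toMackeyDual (f (φ (ψ n)))) (0 : MackeyDual X)

/-- `X` is reflexive: the canonical map of `X` into its bidual is onto. -/
def IsReflexiveSpace (X : Type*) [NormedAddCommGroup X] [NormedSpace ℝ X] : Prop :=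
  Function.Surjective (NormedSpace.inclusionInDoubleDual ℝ X)

/-- `X` contains a closed linear subspace (linearly and topologically) isomorphic to `ℓ¹`. -/
def ContainsEllOne (X : Type*) [NormedAddCommGroup X] [NormedSpace ℝ X] : Prop :=
  ∃ Y : Submodule ℝ X, IsClosed (Y : Set X) ∧ Nonempty (Y ≃L[ℝ] lp (fun _ : ℕ => ℝ) 1)

end

/-! (i) to (ii): if X is not reflexive, `exists_james_seq` gives bounded f_j and x_i with f_j(x_i) ≥
d for j ≤ i and |f_j(x_i)| ≤ d/4 for i < j. A Cesàro limit l of a subsequence of (f_j) has l(x_i) ≤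
d/4 for every i, yet each mean is at least d at a late x_i, so the means stay at norm distance at
least 3d/4 from l. For (μ^s), every Cesàro limit of a subsequence of a weak*-null sequence is 0, and
a Ramsey argument of Erdős–Magidor type yields a subsequence all of whose subsequences are Cesàro
null in norm, hence in the Mackey topology.

(ii) to (i): X* is reflexive, so it contains no ℓ¹ sequence, and Rosenthal's theorem extracts from a
bounded sequence in X* a weak*-convergent subsequence. Property (μ^s) gives Mackey convergence of
means, which is norm convergence because the unit ball of X is weakly compact.

(iii) to (ii) is the main point. If X is not reflexive, take James' sequences again. Without ℓ¹ in
X, `IsConvexNest.exists_tendsto` supplies weak*-convergent h_n in conv{f_j : j ≥ n}, and Rosenthal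
makes (x_i) weakly Cauchy along a subsequence. Subtracting the limit from h_n and applying (μ^s)
gives means that tend to 0 uniformly on the weakly null sequence of successive differences along a
suitable further subsequence. Each mean is small at an early x_i and large at a late one, a
contradiction.

Both extraction theorems are proved by assuming that oscillation persists under every refinement and
building an ℓ¹ sequence from independent sign patterns. -/

/-! ### Infinite Ramsey theory: diagonalisation and the Nash-Williams theorem. -/

/-- In a preorder in which descending sequences have lower bounds, countably many hereditary
predicates can be decided simultaneously. -/
theorem exists_forall_decided {α : Type*} {r : α → α → Prop} (hrefl : ∀ a, r a a)
    (htrans : ∀ a b c, r a b → r b c → r a c)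
    (hσ : ∀ u : ℕ → α, (∀ n, r (u (n + 1)) (u n)) → ∃ b, ∀ n, r b (u n))
    (Q : ℕ → α → Prop) (hQ : ∀ k a b, r b a → Q k a → Q k b) (a : α) :
    ∃ b, r b a ∧ ∀ k, Q k b ∨ ∀ c, r c b → ¬ Q k c := by
  have step : ∀ k a, ∃ b, r b a ∧ (Q k b ∨ ∀ c, r c b → ¬ Q k c) := by
    intro k a
    by_cases h : ∃ c, r c a ∧ Q k c
    · obtain ⟨c, hc, hq⟩ := h
      exact ⟨c, hc, Or.inl hq⟩
    · push Not at h
      exact ⟨a, hrefl a, Or.inr h⟩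
  choose F hF hF' using step
  let u : ℕ → α := fun n => Nat.rec a (fun k b => F k b) n
  have hu : ∀ n, u (n + 1) = F n (u n) := fun n => rfl
  obtain ⟨b, hb⟩ := hσ u fun n => by rw [hu]; exact hF _ _
  refine ⟨b, hb 0, fun k => ?_⟩
  rcases hF' k (u k) with h | h
  · exact Or.inl (hQ k _ _ (hb (k + 1)) h)
  · exact Or.inr fun c hc => h c (htrans _ _ _ hc (hb (k + 1)))

/-- An infinite set of naturals contains an infinite subset whose gaps dominate a given
function. -/
theorem Set.Infinite.exists_sparse_subset {A : Set ℕ} (hA : A.Infinite) (m : ℕ → ℕ) :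
    ∃ B ⊆ A, B.Infinite ∧ ∀ b ∈ B, ∀ b' ∈ B, b < b' → m b ≤ b' := by
  have step : ∀ b : ℕ, ∃ b' ∈ A, b < b' ∧ ∀ i ≤ b, m i ≤ b' := by
    intro b
    obtain ⟨b', hb', h⟩ := hA.exists_gt (b + ∑ i ∈ Finset.range (b + 1), m i)
    refine ⟨b', hb', by omega, fun i hi => ?_⟩
    have := Finset.single_le_sum (f := m) (fun i _ => Nat.zero_le _)
      (Finset.mem_range.2 (show i < b + 1 by omega))
    omega
  choose F hFA hF hFm using step
  let u : ℕ → ℕ := fun n => Nat.rec (F 0) (fun _ b => F b) n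
  have hu : ∀ n, u (n + 1) = F (u n) := fun n => rfl
  have hmono : StrictMono u := strictMono_nat_of_lt_succ fun n => by rw [hu]; exact hF _
  refine ⟨Set.range u, ?_, Set.infinite_range_of_injective hmono.injective, ?_⟩
  · rintro _ ⟨n, rfl⟩
    cases n with
    | zero => exact hFA 0
    | succ n => exact hFA _
  · rintro _ ⟨i, rfl⟩ _ ⟨j, rfl⟩ hij
    obtain ⟨j, rfl⟩ : ∃ k, j = k + 1 := ⟨j - 1, by have : i < j := hmono.lt_iff_lt.1 hij; omega⟩
    have : i < j + 1 := hmono.lt_iff_lt.1 hij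
    rw [hu]
    exact hFm _ _ (hmono.monotone (by omega))

/-- A decreasing (modulo finite sets) sequence of infinite sets has an infinite
pseudo-intersection. -/
theorem exists_pseudoIntersection (u : ℕ → {A : Set ℕ // A.Infinite})
    (hu : ∀ n, ((u (n + 1) : Set ℕ) \ u n).Finite) :
    ∃ b : {A : Set ℕ // A.Infinite}, ∀ n, ((b : Set ℕ) \ u n).Finite := by
  have hfin : ∀ n m, n ≤ m → ((u m : Set ℕ) \ u n).Finite := by
    intro n m hnm
    induction m, hnm using Nat.le_induction with
    | base => simp
    | succ m _ ih =>
      refine (ih.union (hu m)).subset fun x hx => ?_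
      by_cases hxm : x ∈ (u m : Set ℕ)
      · exact Or.inl ⟨hxm, hx.2⟩
      · exact Or.inr ⟨hx.1, hxm⟩
  have hinf : ∀ m, (⋂ n ∈ Finset.range (m + 1), (u n : Set ℕ)).Infinite := by
    intro m
    have hf : (⋃ n ∈ Finset.range (m + 1), ((u m : Set ℕ) \ u n)).Finite :=
      Set.Finite.biUnion (Finset.finite_toSet _) fun n hn =>
        hfin n m (by have := Finset.mem_range.1 (Finset.mem_coe.1 hn); omega)
    refine ((u m).2.sdiff hf).mono fun x hx => ?_
    simp only [Set.mem_sdiff, Set.mem_iUnion, not_exists, not_and, not_not, Set.mem_iInter] at hx ⊢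
    exact fun n hn => hx.2 n hn hx.1
  have step : ∀ m b : ℕ, ∃ b', b < b' ∧ ∀ n ≤ m, b' ∈ (u n : Set ℕ) := by
    intro m b
    obtain ⟨b', hb', h⟩ := (hinf m).exists_gt b
    simp only [Set.mem_iInter] at hb'
    exact ⟨b', h, fun n hn => hb' n (Finset.mem_range.2 (by omega))⟩
  choose F hF hFu using step
  let v : ℕ → ℕ := fun n => Nat.rec (F 0 0) (fun k b => F (k + 1) b) n
  have hv : ∀ n, v (n + 1) = F (n + 1) (v n) := fun n => rfl
  have hmono : StrictMono v := strictMono_nat_of_lt_succ fun n => by rw [hv]; exact hF _ _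
  have hmem : ∀ n k, n ≤ k → v k ∈ (u n : Set ℕ) := by
    intro n k hnk
    cases k with
    | zero => exact hFu 0 0 n hnk
    | succ k => exact hFu (k + 1) _ n hnk
  refine ⟨⟨Set.range v, Set.infinite_range_of_injective hmono.injective⟩, fun n => ?_⟩
  refine ((Finset.range n).finite_toSet.image v).subset ?_
  rintro _ ⟨⟨k, rfl⟩, hk⟩
  refine ⟨k, ?_, rfl⟩
  by_contra h
  exact hk (hmem n k (by simpa using h))

/-- Countably many properties of infinite sets which are hereditary modulo finite sets can be
decided by one infinite set. -/
theorem Set.Infinite.exists_forall_decided {A : Set ℕ} (hA : A.Infinite)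
    (Q : ℕ → Set ℕ → Prop)
    (hQ : ∀ k (A B : Set ℕ), B.Infinite → (B \ A).Finite → Q k A → Q k B) :
    ∃ B ⊆ A, B.Infinite ∧ ∀ k, Q k B ∨ ∀ C : Set ℕ, C.Infinite → (C \ B).Finite → ¬ Q k C := by
  obtain ⟨⟨B, hB⟩, hBA, h⟩ := _root_.exists_forall_decided
    (α := {A : Set ℕ // A.Infinite}) (r := fun A B => ((A : Set ℕ) \ B).Finite)
    (fun a => by simp)
    (fun a b c hab hbc => (hab.union hbc).subset fun x hx => by
      by_cases hxb : x ∈ (b : Set ℕ)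
      · exact Or.inr ⟨hxb, hx.2⟩
      · exact Or.inl ⟨hx.1, hxb⟩)
    exists_pseudoIntersection (fun k A => Q k A) (fun k A B h hq => hQ k A B B.2 h hq) ⟨A, hA⟩
  have hBA' : (B \ A).Finite := hBA
  have hinf : (A ∩ B).Infinite := by
    have := hB.sdiff hBA'
    exact this.mono fun x hx => ⟨by_contra fun h => hx.2 ⟨hx.1, h⟩, hx.1⟩
  refine ⟨A ∩ B, Set.inter_subset_left, hinf, fun k => ?_⟩
  rcases h k with h | h
  · exact Or.inl (hQ k B _ hinf (by simp [Set.sdiff_eq_empty.2 Set.inter_subset_right]) h)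
  · exact Or.inr fun C hC hCB => h ⟨C, hC⟩ (hCB.subset fun x hx =>
      ⟨hx.1, fun h => hx.2 h.2⟩)

/-- The Nash-Williams theorem: a property of infinite sets of naturals which is open, i.e. depends
on an initial segment only, is homogeneous on some infinite set. -/
theorem exists_homogeneous_set (P : Set ℕ → Prop)
    (hP : ∀ A : Set ℕ, A.Infinite → P A →
      ∃ n, ∀ B : Set ℕ, B.Infinite → (∀ i < n, i ∈ B ↔ i ∈ A) → P B) :
    ∃ A : Set ℕ, A.Infinite ∧
      ((∀ B ⊆ A, B.Infinite → P B) ∨ (∀ B ⊆ A, B.Infinite → ¬ P B)) := by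
  classical
  -- Acceptance of a finite stem `s` by `A`. The threshold `m` makes it insensitive to finite
  -- changes of `A`, so that all stems can be decided by a single set.
  let acc : Finset ℕ → Set ℕ → Prop := fun s A =>
    ∃ m, ∀ B ⊆ A, B.Infinite → (∀ b ∈ B, m ≤ b) → P (s ∪ B)
  have hacc : ∀ s (A B : Set ℕ), B.Infinite → (B \ A).Finite → acc s A → acc s B := by
    rintro s A B - hBA ⟨m, hm⟩
    obtain ⟨N, hN⟩ := hBA.bddAbove
    refine ⟨max m (N + 1), fun C hCB hC hCm => hm C (fun x hx => ?_) hC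
      fun b hb => (le_max_left _ _).trans (hCm b hb)⟩
    by_contra hxA
    have h1 := hN ⟨hCB hx, hxA⟩
    have h2 := (le_max_right _ _).trans (hCm x hx)
    omega
  obtain ⟨e, he⟩ := exists_surjective_nat (Finset ℕ)
  obtain ⟨A, -, hA, hdec⟩ := Set.infinite_univ.exists_forall_decided (fun k => acc (e k))
    (fun k => hacc (e k))
  have hdec' : ∀ s, acc s A ∨ ∀ C : Set ℕ, C.Infinite → (C \ A).Finite → ¬ acc s C := by
    intro s
    obtain ⟨k, rfl⟩ := he s
    exact hdec k
  by_cases h0 : acc ∅ A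
  · obtain ⟨m, hm⟩ := h0
    refine ⟨A \ Set.Iio m, hA.sdiff (Set.finite_Iio m), Or.inl fun B hB hBi => ?_⟩
    simpa using hm B (fun x hx => (hB hx).1) hBi fun b hb => by simpa using (hB hb).2
  -- for a rejected `s` almost all one-point extensions are rejected
  have key : ∀ s, ∃ t, ¬ acc s A → ∀ n ∈ A, t ≤ n → ¬ acc (insert n s) A := by
    intro s
    by_contra! hcon
    have hs : ¬ acc s A := (hcon 0).1
    have hinf : {n ∈ A | acc (insert n s) A}.Infinite := by
      refine Set.infinite_of_not_bddAbove fun ⟨N, hN⟩ => ?_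
      obtain ⟨n, hnA, hn, hn'⟩ := (hcon (N + 1)).2
      have := hN ⟨hnA, hn'⟩
      omega
    have hm : ∀ n, ∃ m, acc (insert n s) A →
        ∀ B ⊆ A, B.Infinite → (∀ b ∈ B, m ≤ b) → P (↑(insert n s) ∪ B) := by
      intro n
      by_cases h : acc (insert n s) A
      · obtain ⟨m, hm⟩ := h
        exact ⟨m, fun _ => hm⟩
      · exact ⟨0, fun h' => absurd h' h⟩
    choose m hm using hm
    obtain ⟨B, hBA, hB, hBm⟩ := hinf.exists_sparse_subset m
    have hBA' : B ⊆ A := fun x hx => (hBA hx).1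
    -- Any infinite `C ⊆ B` has a least element `n` whose extension of `s` is accepted, and
    -- sparseness puts the rest of `C` beyond `m n`. Hence `B` would accept `s`.
    refine (hdec' s).resolve_left hs B hB (by simp [Set.sdiff_eq_empty.2 hBA']) ⟨0, ?_⟩
    rintro C hCB hC -
    have hn : sInf C ∈ C := Nat.sInf_mem hC.nonempty
    have := hm (sInf C) (hBA (hCB hn)).2 (C \ {sInf C}) (fun x hx => hBA' (hCB hx.1))
      (hC.sdiff (Set.finite_singleton _)) (fun b hb => hBm _ (hCB hn) _ (hCB hb.1)
        (lt_of_le_of_ne (Nat.sInf_le hb.1) fun h => hb.2 h.symm))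
    convert this using 1
    ext x
    by_cases hx : x = sInf C
    · simp [hx, hn]
    · simp [hx]
  choose t ht using key
  -- The supremum runs over all stems inside `[0, b]`, so the next element of `B` exceeds the
  -- threshold `t` of each of them.
  obtain ⟨B, hBA, hB, hBm⟩ := (hA.sdiff (Set.finite_Iio (t ∅))).exists_sparse_subset
    (fun b => (Finset.range (b + 1)).powerset.sup t)
  have hrej : ∀ s : Finset ℕ, (s : Set ℕ) ⊆ B → ¬ acc s A := by
    intro s
    induction s using Finset.induction_on_max with
    | empty => exact fun _ => h0
    | insert a s hs ih =>
      intro hsB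
      have hsB' : (s : Set ℕ) ⊆ B := fun x hx => hsB (by simp at hx; simp [hx])
      have haB : a ∈ B := hsB (by simp)
      refine ht s (ih hsB') a (hBA haB).1 ?_
      rcases s.eq_empty_or_nonempty with rfl | hne
      · simpa using (hBA haB).2
      · have hmax := s.max'_mem hne
        refine le_trans ?_ (hBm _ (hsB' hmax) a haB (hs _ hmax))
        refine Finset.le_sup (f := t) (Finset.mem_powerset.2 fun x hx => ?_)
        exact Finset.mem_range.2 (Nat.lt_succ_of_le (s.le_max' x hx))
  -- By openness, a set `C ⊆ B` with property `P` would have an accepted initial segment.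
  refine ⟨B, hB, Or.inr fun C hCB hC hPC => ?_⟩
  obtain ⟨n, hn⟩ := hP C hC hPC
  refine hrej ((Finset.range n).filter (· ∈ C)) (fun x hx => hCB (by simp at hx; exact hx.2))
    ⟨n, fun D _ hD hDn => hn _ (hD.mono Set.subset_union_right) fun i hi => ?_⟩
  simp only [Finset.coe_filter, Finset.mem_range, Set.mem_union, Set.mem_ofPred_eq]
  exact ⟨fun h => h.elim (fun h => h.2) fun h => absurd (hDn i h) (by omega),
    fun h => Or.inl ⟨hi, h⟩⟩

theorem StrictMono.eq_nth_range {a : ℕ → ℕ} (ha : StrictMono a) :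
    a = Nat.nth (· ∈ Set.range a) := by
  have hinf : (Set.range a).Infinite := Set.infinite_range_of_injective ha.injective
  refine (ha.range_inj (Nat.nth_strictMono hinf)).1 ?_
  rw [Nat.range_nth_of_infinite hinf]
  rfl

/-- The Nash-Williams theorem for open properties of strictly increasing sequences. -/
theorem exists_homogeneous_subseq (P : (ℕ → ℕ) → Prop)
    (hP : ∀ a, StrictMono a → P a → ∃ n, ∀ b, StrictMono b → (∀ i < n, b i = a i) → P b) :
    ∃ φ : ℕ → ℕ, StrictMono φ ∧ ((∀ ψ : ℕ → ℕ, StrictMono ψ → P (φ ∘ ψ)) ∨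
      (∀ ψ : ℕ → ℕ, StrictMono ψ → ¬ P (φ ∘ ψ))) := by
  classical
  obtain ⟨A, hA, h⟩ := exists_homogeneous_set (fun A => P (Nat.nth (· ∈ A))) (by
    intro A hA hPA
    obtain ⟨n, hn⟩ := hP _ (Nat.nth_strictMono hA) hPA
    refine ⟨Nat.nth (· ∈ A) n, fun B hB hBA => hn _ (Nat.nth_strictMono hB) fun i hi => ?_⟩
    have hlt : Nat.nth (· ∈ A) i < Nat.nth (· ∈ A) n := Nat.nth_strictMono hA hi
    have hmem : Nat.nth (· ∈ A) i ∈ A := Nat.nth_mem_of_infinite hA i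
    have hcount : Nat.count (· ∈ B) (Nat.nth (· ∈ A) i) = i := by
      conv_rhs => rw [← Nat.count_nth_of_infinite (p := (· ∈ A)) hA i]
      rw [Nat.count_eq_card_filter_range, Nat.count_eq_card_filter_range]
      congr 1
      refine Finset.filter_congr fun k hk => hBA k ?_
      exact (Finset.mem_range.1 hk).trans hlt
    have := Nat.nth_count (p := (· ∈ B)) ((hBA _ hlt).2 hmem)
    rwa [hcount] at this)
  have hmono := Nat.nth_strictMono (p := (· ∈ A)) hA
  have hsub : ∀ ψ : ℕ → ℕ, StrictMono ψ → Set.range (Nat.nth (· ∈ A) ∘ ψ) ⊆ A := by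
    rintro ψ - _ ⟨k, rfl⟩
    exact Nat.nth_mem_of_infinite hA _
  refine ⟨Nat.nth (· ∈ A), hmono, h.imp (fun h ψ hψ => ?_) (fun h ψ hψ => ?_)⟩
  all_goals
    rw [(hmono.comp hψ).eq_nth_range]
    exact h _ (hsub ψ hψ) (Set.infinite_range_of_injective (hmono.comp hψ).injective)

/-! ### Sequences equivalent to the ℓ¹ basis. -/

/-- A closed subspace is the intersection of the kernels of the functionals vanishing on it. -/
theorem Submodule.exists_strongDual_eq_zero_of_notMem {E : Type*} [NormedAddCommGroup E]
    [NormedSpace ℝ E] (p : Submodule ℝ E) (hp : IsClosed (p : Set E)) {x : E} (hx : x ∉ p) :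
    ∃ f : StrongDual ℝ E, (∀ y ∈ p, f y = 0) ∧ 0 < f x := by
  obtain ⟨f, u, hfu, hu⟩ := geometric_hahn_banach_closed_point p.convex hp hx
  have h0 : ∀ y ∈ p, f y = 0 := by
    intro y hy
    by_contra hne
    have := hfu _ (p.smul_mem ((u + 1) / f y) hy)
    rw [map_smul, smul_eq_mul, div_mul_cancel₀ _ hne] at this
    linarith
  refine ⟨f, h0, ?_⟩
  have := hfu 0 p.zero_mem
  rw [map_zero] at this
  linarith

/-- The sequence `x` is bounded and dominates the unit vector basis of `ℓ¹`, i.e. it is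
equivalent to that basis. -/
def IsEllOneSeq {E : Type*} [NormedAddCommGroup E] [NormedSpace ℝ E] (x : ℕ → E) : Prop :=
  (∃ C : ℝ, ∀ i, ‖x i‖ ≤ C) ∧
    ∃ c : ℝ, 0 < c ∧ ∀ (s : Finset ℕ) (a : ℕ → ℝ), c * ∑ i ∈ s, |a i| ≤ ‖∑ i ∈ s, a i • x i‖

section EllOne

variable {E : Type*} [NormedAddCommGroup E] [NormedSpace ℝ E]

/-- A bounded sequence on which all finite sign patterns are realised by functionals of norm at
most one, with a uniform gap, is equivalent to the `ℓ¹` basis. -/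
theorem IsEllOneSeq.of_independent {x : ℕ → E} {C : ℝ} (hx : ∀ i, ‖x i‖ ≤ C) {u d : ℕ → ℝ}
    {δ : ℝ} (hδ : 0 < δ) (hud : ∀ i, d i + δ ≤ u i)
    (hs : ∀ (s : Set ℕ) (m : ℕ), ∃ f : StrongDual ℝ E, ‖f‖ ≤ 1 ∧
      ∀ i < m, (i ∈ s → u i ≤ f (x i)) ∧ (i ∉ s → f (x i) ≤ d i)) : IsEllOneSeq x := by
  refine ⟨⟨C, hx⟩, δ / 2, by positivity, fun t a => ?_⟩
  -- `f` realises the sign pattern of `a` and `g` the opposite one. In `f - g` the thresholds cancel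
  -- and only the gap `δ` remains; the two norms account for the constant `δ / 2`.
  obtain ⟨f, hf1, hf⟩ := hs {i | 0 ≤ a i} (t.sup id + 1)
  obtain ⟨g, hg1, hg⟩ := hs {i | a i < 0} (t.sup id + 1)
  set v := ∑ i ∈ t, a i • x i with hv
  have key : δ * ∑ i ∈ t, |a i| ≤ f v - g v := by
    simp only [hv, map_sum, map_smul, smul_eq_mul]
    rw [← Finset.sum_sub_distrib, Finset.mul_sum]
    refine Finset.sum_le_sum fun i hi => ?_
    have him : i < t.sup id + 1 := Nat.lt_succ_of_le (Finset.le_sup (f := id) hi)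
    have hd := hud i
    rcases le_or_gt 0 (a i) with h | h
    · have h1 := (hf i him).1 h
      have h2 := (hg i him).2 (by simpa using h)
      rw [abs_of_nonneg h]
      nlinarith
    · have h1 := (hf i him).2 (by simpa using h)
      have h2 := (hg i him).1 h
      rw [abs_of_neg h]
      nlinarith
  have h1 : f v ≤ ‖v‖ := (le_abs_self _).trans (by simpa using f.le_of_opNorm_le hf1 v)
  have h2 : -g v ≤ ‖v‖ := (neg_le_abs _).trans (by simpa using g.le_of_opNorm_le hg1 v)
  linarith

/-- Every bounded family of scalars is interpolated on an `ℓ¹` sequence by a functional. -/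
theorem IsEllOneSeq.exists_interpolation {x : ℕ → E} (hx : IsEllOneSeq x) :
    ∃ K : ℝ, 0 < K ∧ ∀ b : ℕ → ℝ, (∀ i, |b i| ≤ 1) →
      ∃ f : StrongDual ℝ E, ‖f‖ ≤ K ∧ ∀ i, f (x i) = b i := by
  obtain ⟨-, c, hc, h⟩ := hx
  refine ⟨1 / c, by positivity, fun b hb => ?_⟩
  let L := Finsupp.linearCombination ℝ x
  have hL : ∀ a : ℕ →₀ ℝ, c * ∑ i ∈ a.support, |a i| ≤ ‖L a‖ := fun a => by
    simpa [L, Finsupp.linearCombination_apply, Finsupp.sum] using h a.support a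
  have hinj : Function.Injective L := by
    rw [← LinearMap.ker_eq_bot, LinearMap.ker_eq_bot']
    intro a ha
    have h1 := hL a
    rw [ha, norm_zero] at h1
    have h2 : ∑ i ∈ a.support, |a i| = 0 :=
      le_antisymm (by nlinarith) (Finset.sum_nonneg fun i _ => abs_nonneg _)
    rw [Finset.sum_eq_zero_iff_of_nonneg fun i _ => abs_nonneg _] at h2
    ext i
    by_contra hi
    exact hi (by simpa using h2 i (by simpa using hi))
  let e := LinearEquiv.ofInjective L hinj
  let g₀ : LinearMap.range L →ₗ[ℝ] ℝ := Finsupp.linearCombination ℝ b ∘ₗ e.symm.toLinearMap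
  have hg₀ : ∀ y, ‖g₀ y‖ ≤ 1 / c * ‖y‖ := by
    intro y
    obtain ⟨a, rfl⟩ := e.surjective y
    have h1 : g₀ (e a) = ∑ i ∈ a.support, a i * b i := by
      simp [g₀, Finsupp.linearCombination_apply, Finsupp.sum]
    have h2 : ‖e a‖ = ‖L a‖ := rfl
    rw [h1, h2]
    have h3 : ‖∑ i ∈ a.support, a i * b i‖ ≤ ∑ i ∈ a.support, |a i| := by
      refine norm_sum_le_of_le _ fun i _ => ?_
      rw [Real.norm_eq_abs, abs_mul]
      exact mul_le_of_le_one_right (abs_nonneg _) (hb i)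
    rw [one_div, ← div_eq_inv_mul, le_div_iff₀ hc]
    nlinarith [hL a]
  obtain ⟨f, hf, hfn⟩ := exists_extension_norm_eq (𝕜 := ℝ) _ (g₀.mkContinuous _ hg₀)
  refine ⟨f, hfn.trans_le (LinearMap.mkContinuous_norm_le _ (by positivity) _), fun i => ?_⟩
  have h1 : L (Finsupp.single i 1) = x i := by simp [L]
  have h2 := hf (e (Finsupp.single i 1))
  have h3 : ((e (Finsupp.single i 1) : LinearMap.range L) : E) = x i := h1
  rw [h3] at h2
  rw [h2]
  simp [g₀]

/-- A reflexive space contains no `ℓ¹` sequence. -/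
theorem IsReflexiveSpace.not_isEllOneSeq (hE : IsReflexiveSpace E) (x : ℕ → E) :
    ¬ IsEllOneSeq x := by
  intro hx
  obtain ⟨C, hC⟩ := hx.1
  obtain ⟨K, hK, hint⟩ := hx.exists_interpolation
  -- a weak cluster point of the sequence
  obtain ⟨y, hy⟩ : ∃ y : E, ∀ f : StrongDual ℝ E,
      Tendsto (fun n => f (x n)) (hyperfilter ℕ : Filter ℕ) (𝓝 (f y)) := by
    let J : ℕ → WeakDual ℝ (StrongDual ℝ E) := fun n =>
      StrongDual.toWeakDual (NormedSpace.inclusionInDoubleDual ℝ E (x n))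
    have hcpt := WeakDual.isCompact_closedBall (𝕜 := ℝ) (0 : StrongDual ℝ (StrongDual ℝ E)) C
    obtain ⟨φ, -, hφ⟩ := hcpt.ultrafilter_le_nhds ((hyperfilter ℕ).map J) (by
      simp only [Ultrafilter.coe_map, le_principal_iff]
      refine Filter.mem_map.2 (Filter.univ_mem' fun n => ?_)
      simp only [Set.mem_preimage, mem_closedBall_zero_iff]
      exact (NormedSpace.double_dual_bound ℝ E (x n)).trans (hC n))
    obtain ⟨y, hy⟩ := hE (WeakDual.toStrongDual φ)
    refine ⟨y, fun f => ?_⟩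
    have h1 := ((WeakDual.eval_continuous f).tendsto φ).comp hφ
    have h2 : f y = φ f := by
      rw [← NormedSpace.dual_def, hy]; rfl
    rw [h2]
    exact h1.comp tendsto_map
  have hyp : y ∈ (Submodule.span ℝ (Set.range x)).topologicalClosure := by
    by_contra hn
    obtain ⟨f, hf0, hf⟩ := Submodule.exists_strongDual_eq_zero_of_notMem _
      (Submodule.isClosed_topologicalClosure _) hn
    have h1 : ∀ n, f (x n) = 0 := fun n =>
      hf0 _ (Submodule.le_topologicalClosure _ (Submodule.subset_span ⟨n, rfl⟩))
    have h2 := hy f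
    simp only [h1] at h2
    exact hf.ne (tendsto_nhds_unique tendsto_const_nhds h2)
  obtain ⟨z, hz, hyz⟩ := Metric.mem_closure_iff.1 hyp (1 / (4 * K)) (by positivity)
  obtain ⟨a, rfl⟩ := (Finsupp.mem_span_range_iff_exists_finsupp).1 hz
  rw [dist_eq_norm] at hyz
  -- `f` and `g` agree at the finite combination near `y`, but almost every `x n` has index off its
  -- support, so `f y = 1` and `g y = 0`. The distance `1 / (4 * K)` is too small for both.
  obtain ⟨f, hfK, hf⟩ := hint (fun _ => 1) (by simp)
  obtain ⟨g, hgK, hg⟩ := hint (fun i => if i ∈ a.support then 1 else 0) (fun i => by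
    split_ifs <;> simp)
  have hfy : f y = 1 := by
    have h2 := hy f
    simp only [hf] at h2
    exact tendsto_nhds_unique h2 tendsto_const_nhds
  have hgy : g y = 0 := by
    have h2 := hy g
    refine tendsto_nhds_unique h2 (tendsto_const_nhds.congr' ?_)
    have : ∀ᶠ n in (hyperfilter ℕ : Filter ℕ), n ∉ a.support := by
      refine hyperfilter_le_cofinite ?_
      exact (a.support.finite_toSet).compl_mem_cofinite
    filter_upwards [this] with n hn
    rw [hg, if_neg hn]
  have hfg : f (a.sum fun i c => c • x i) = g (a.sum fun i c => c • x i) := by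
    simp only [Finsupp.sum, map_sum, map_smul, hf, hg]
    refine Finset.sum_congr rfl fun i hi => ?_
    rw [if_pos hi]
  set z := a.sum fun i c => c • x i
  have h1 : |f (y - z)| ≤ K * ‖y - z‖ := f.le_of_opNorm_le hfK _
  have h2 : |g (y - z)| ≤ K * ‖y - z‖ := g.le_of_opNorm_le hgK _
  have h3 : K * ‖y - z‖ < 1 / 4 := by
    calc K * ‖y - z‖ < K * (1 / (4 * K)) := by gcongr
      _ = 1 / 4 := by field_simp
  rw [map_sub, hfy] at h1
  rw [map_sub, hgy] at h2
  rw [hfg] at h1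
  have := abs_le.1 h1
  have := abs_le.1 h2
  linarith

theorem ContainsEllOne.exists_isEllOneSeq (h : ContainsEllOne E) :
    ∃ x : ℕ → E, IsEllOneSeq x := by
  obtain ⟨Y, -, ⟨e⟩⟩ := h
  let b : ℕ → lp (fun _ : ℕ => ℝ) 1 := fun i => lp.single 1 i (1 : ℝ)
  have hb : ∀ (s : Finset ℕ) (a : ℕ → ℝ), ‖∑ i ∈ s, a i • b i‖ = ∑ i ∈ s, |a i| := by
    intro s a
    have h1 : ∀ i, a i • b i = lp.single 1 i (a i) := fun i => by
      rw [← lp.single_smul]; simp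
    simp only [h1]
    have := lp.norm_sum_single (p := 1) (E := fun _ : ℕ => ℝ) (by simp) a s
    simpa using this
  refine ⟨fun i => (e.symm (b i) : E), ⟨‖(e.symm : lp (fun _ : ℕ => ℝ) 1 →L[ℝ] Y)‖, fun i => ?_⟩,
    (‖(e : Y →L[ℝ] lp (fun _ : ℕ => ℝ) 1)‖ + 1)⁻¹, by positivity, fun s a => ?_⟩
  · have h1 := (e.symm : lp (fun _ : ℕ => ℝ) 1 →L[ℝ] Y).le_opNorm (b i)
    have h2 : ‖b i‖ = 1 := by simpa using hb {i} (fun _ => 1)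
    simpa [h2] using h1
  · have h1 := (e : Y →L[ℝ] lp (fun _ : ℕ => ℝ) 1).le_opNorm (e.symm (∑ i ∈ s, a i • b i))
    simp only [ContinuousLinearEquiv.coe_coe, ContinuousLinearEquiv.apply_symm_apply, hb] at h1
    have h2 : ‖∑ i ∈ s, a i • (e.symm (b i) : E)‖ = ‖e.symm (∑ i ∈ s, a i • b i)‖ := by
      have h3 : ((e.symm (∑ i ∈ s, a i • b i) : Y) : E) = ∑ i ∈ s, a i • (e.symm (b i) : E) := by
        simp
      rw [← h3, Submodule.coe_norm]
    rw [h2, inv_mul_le_iff₀ (by positivity)]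
    exact h1.trans (by gcongr; linarith)

/-- The operator sending `a` to the sum of `a i • x i` is bounded on ℓ¹ and bounded below, so its
range is closed and isomorphic to ℓ¹. -/
theorem IsEllOneSeq.containsEllOne [CompleteSpace E] {x : ℕ → E} (hx : IsEllOneSeq x) :
    ContainsEllOne E := by
  obtain ⟨⟨C, hC⟩, c, hc, h⟩ := hx
  have hab : ∀ a : lp (fun _ : ℕ => ℝ) 1, HasSum (fun i => |a i|) ‖a‖ := fun a => by
    simpa using lp.hasSum_norm (p := 1) (by simp) a
  have hbd : ∀ (a : lp (fun _ : ℕ => ℝ) 1) i, ‖a i • x i‖ ≤ C * |a i| := fun a i => by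
    rw [norm_smul, mul_comm, Real.norm_eq_abs]
    exact mul_le_mul_of_nonneg_right (hC i) (abs_nonneg _)
  have hsum : ∀ a : lp (fun _ : ℕ => ℝ) 1, Summable fun i => a i • x i := fun a =>
    Summable.of_norm_bounded ((hab a).summable.mul_left C) (hbd a)
  let T₀ : lp (fun _ : ℕ => ℝ) 1 →ₗ[ℝ] E :=
    { toFun := fun a => ∑' i, a i • x i
      map_add' := fun a b => by
        rw [← (hsum a).tsum_add (hsum b)]
        simp [add_smul]
      map_smul' := fun r a => by
        rw [RingHom.id_apply, ← (hsum a).tsum_const_smul]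
        simp [mul_smul] }
  let T := T₀.mkContinuous C fun a =>
    tsum_of_norm_bounded ((hab a).mul_left C) (hbd a)
  have hT : ∀ a, c * ‖a‖ ≤ ‖T a‖ := fun a =>
    le_of_tendsto_of_tendsto' ((hab a).mul_left c) (hsum a).hasSum.norm fun s => by
      rw [← Finset.mul_sum]; exact h s a
  have hanti : AntilipschitzWith (Real.toNNReal c⁻¹) T :=
    AddMonoidHomClass.antilipschitz_of_bound T fun a => by
      rw [Real.coe_toNNReal _ (by positivity), ← div_eq_inv_mul, le_div_iff₀ hc, mul_comm]
      exact hT a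
  have hcl : IsClosed (Set.range T) := hanti.isClosed_range T.uniformContinuous
  exact ⟨T.range, hcl, ⟨(T.equivRange hanti.injective hcl).symm⟩⟩

end EllOne

/-! ### Weakly Cauchy subsequences. -/

/-- Rosenthal's `ℓ¹` theorem. -/
theorem exists_weaklyCauchy_subseq {E : Type*} [NormedAddCommGroup E] [NormedSpace ℝ E]
    (hE : ∀ y : ℕ → E, ¬ IsEllOneSeq y) {x : ℕ → E} {C : ℝ} (hx : ∀ n, ‖x n‖ ≤ C) :
    ∃ φ : ℕ → ℕ, StrictMono φ ∧ ∀ f : StrongDual ℝ E, ∃ l : ℝ,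
      Tendsto (fun n => f (x (φ n))) atTop (𝓝 l) := by
  obtain ⟨e, he⟩ := exists_surjective_nat (ℚ × ℚ)
  obtain ⟨B, -, hB, hdec⟩ := Set.infinite_univ.exists_forall_decided
    (fun k A => ∀ f : StrongDual ℝ E, ‖f‖ ≤ 1 → (e k).1 < (e k).2 →
      ¬ ({n ∈ A | f (x n) < (e k).1}.Infinite ∧ {n ∈ A | (e k).2 < f (x n)}.Infinite)) (by
    rintro k A B - hBA hA f hf hk h
    have aux : ∀ p : ℕ → Prop, {n ∈ B | p n}.Infinite → {n ∈ A | p n}.Infinite := by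
      intro p hp
      refine (hp.sdiff hBA).mono fun n hn => ⟨?_, hn.1.2⟩
      by_contra hnA
      exact hn.2 ⟨hn.1.1, hnA⟩
    exact hA f hf hk ⟨aux _ h.1, aux _ h.2⟩)
  have hφ : StrictMono (Nat.nth (· ∈ B)) := Nat.nth_strictMono hB
  set φ := Nat.nth (· ∈ B) with hφdef
  have hφB : ∀ n, φ n ∈ B := fun n => Nat.nth_mem_of_infinite hB n
  by_cases hall : ∀ k, ∀ f : StrongDual ℝ E, ‖f‖ ≤ 1 → (e k).1 < (e k).2 →
      ¬ ({n ∈ B | f (x n) < (e k).1}.Infinite ∧ {n ∈ B | (e k).2 < f (x n)}.Infinite)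
  · refine ⟨φ, hφ, fun f => ?_⟩
    have hball : ∀ g : StrongDual ℝ E, ‖g‖ ≤ 1 → ∃ l : ℝ,
        Tendsto (fun n => g (x (φ n))) atTop (𝓝 l) := by
      intro g hg
      have hb : ∀ n, |g (x (φ n))| ≤ C := fun n =>
        (g.le_of_opNorm_le hg _).trans (by simpa using hx _)
      refine tendsto_of_no_upcrossings Rat.denseRange_cast ?_
        (isBoundedUnder_of ⟨C, fun n => (abs_le.1 (hb n)).2⟩)
        (isBoundedUnder_of ⟨-C, fun n => (abs_le.1 (hb n)).1⟩)
      rintro _ ⟨r, rfl⟩ _ ⟨s, rfl⟩ hrs ⟨h1, h2⟩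
      obtain ⟨k, hk⟩ := he (r, s)
      have aux : ∀ p : ℕ → Prop, (∃ᶠ n in atTop, p (φ n)) → {n ∈ B | p n}.Infinite := by
        intro p hp
        have := (Nat.frequently_atTop_iff_infinite.1 hp).image hφ.injective.injOn
        refine this.mono ?_
        rintro _ ⟨n, hn, rfl⟩
        exact ⟨hφB n, hn⟩
      refine hall k g hg (by rw [hk]; exact_mod_cast hrs) ⟨?_, ?_⟩
      · rw [hk]; exact aux _ h1
      · rw [hk]; exact aux _ h2
    obtain ⟨l, hl⟩ := hball ((‖f‖ + 1)⁻¹ • f) (by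
      rw [norm_smul, norm_inv, Real.norm_of_nonneg (by positivity), inv_mul_le_iff₀ (by positivity)]
      linarith)
    refine ⟨(‖f‖ + 1) * l, (hl.const_mul (‖f‖ + 1)).congr fun n => ?_⟩
    have : ‖f‖ + 1 ≠ 0 := by positivity
    simp [this]
  · exfalso
    push Not at hall
    obtain ⟨k, f₀, hf₀, hrs, h0⟩ := hall
    -- One rational gap `(r, s)` is now crossed infinitely often, on every infinite subset of `B`,
    -- by some functional of the unit ball.
    have hk := (hdec k).resolve_left fun h => h f₀ hf₀ hrs h0
    set r := (e k).1
    set s := (e k).2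
    -- The property says that some finite initial part of the alternating pattern is realised by no
    -- functional of the unit ball; it is therefore open.
    obtain ⟨χ, hχ, hhom⟩ := exists_homogeneous_subseq
      (fun a => ∃ N, ∀ f : StrongDual ℝ E, ‖f‖ ≤ 1 →
        ¬ ∀ i < N, (Even i → f (x (φ (a i))) < r) ∧ (¬ Even i → s < f (x (φ (a i))))) (by
      rintro a - ⟨N, hN⟩
      refine ⟨N, fun b _ hb => ⟨N, fun f hf h => hN f hf fun i hi => ?_⟩⟩
      rw [← hb i hi]
      exact h i hi)
    rcases hhom with hhom | hhom
    · -- some functional oscillates along the homogeneous subsequence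
      have hinf := Set.infinite_range_of_injective (hφ.comp hχ).injective
      have hsub : Set.range (φ ∘ χ) ⊆ B := by rintro _ ⟨n, rfl⟩; exact hφB _
      have := hk _ hinf (by simp [Set.sdiff_eq_empty.2 hsub])
      push Not at this
      obtain ⟨f, hf, -, h1, h2⟩ := this
      have aux : ∀ p : ℕ → Prop, {n ∈ Set.range (φ ∘ χ) | p n}.Infinite →
          ∃ᶠ n in atTop, p (φ (χ n)) := by
        intro p hp
        refine Nat.frequently_atTop_iff_infinite.2 fun hfin => hp ?_
        refine (hfin.image (φ ∘ χ)).subset ?_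
        rintro _ ⟨⟨n, rfl⟩, hn⟩
        exact ⟨n, hn, rfl⟩
      obtain ⟨ψ, hψ, hpat⟩ := extraction_forall_of_frequently
        (P := fun i n => (Even i → f (x (φ (χ n))) < r) ∧ (¬ Even i → s < f (x (φ (χ n))))) (by
        intro i
        by_cases hi : Even i
        · simpa [hi] using aux _ h1
        · simpa [hi] using aux _ h2)
      obtain ⟨N, hN⟩ := hhom ψ hψ
      exact hN f hf fun i _ => hpat i
    · refine hE (fun i => x (φ (χ (3 * i + 1)))) (IsEllOneSeq.of_independent (fun i => hx _)
        (u := fun _ => s) (d := fun _ => r) (δ := s - r) (by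
          have : (r : ℝ) < s := by exact_mod_cast hrs
          linarith) (fun _ => by linarith) ?_)
      classical
      intro S m
      -- Block `i` uses `3i, 3i + 1` if `i ∈ S` and `3i + 1, 3i + 2` otherwise. So `3i + 1` sits in
      -- an odd position (value above `s`) or in an even one (value below `r`), as prescribed by
      -- `S`.
      let ψ : ℕ → ℕ := fun j =>
        3 * (j / 2) + (if j / 2 ∈ S then 0 else 1) + (if Even j then 0 else 1)
      have hψ : StrictMono ψ := strictMono_nat_of_lt_succ fun j => by
        rcases Nat.even_or_odd' j with ⟨i, rfl | rfl⟩
        · have h1 : (2 * i + 1) / 2 = i := by omega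
          have h2 : 2 * i / 2 = i := by omega
          simp [ψ, h1, h2]
        · have h1 : (2 * i + 1) / 2 = i := by omega
          have h2 : (2 * i + 1 + 1) / 2 = i + 1 := by omega
          have h3 : Even (2 * i + 1 + 1) := ⟨i + 1, by ring⟩
          simp only [ψ, h1, h2, h3, if_true]
          split_ifs <;> omega
      have := hhom ψ hψ
      push Not at this
      obtain ⟨f, hf, h⟩ := this (2 * m)
      refine ⟨f, hf, fun i hi => ⟨fun hiS => ?_, fun hiS => ?_⟩⟩
      · have h1 := (h (2 * i + 1) (by omega)).2 (by simp)
        have h2 : (2 * i + 1) / 2 = i := by omega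
        have h3 : ψ (2 * i + 1) = 3 * i + 1 := by simp [ψ, h2, hiS]
        rw [Function.comp_apply, h3] at h1
        exact h1.le
      · have h1 := (h (2 * i) (by omega)).1 (by simp)
        have h2 : 2 * i / 2 = i := by omega
        have h3 : ψ (2 * i) = 3 * i + 1 := by simp [ψ, h2, hiS]
        rw [Function.comp_apply, h3] at h1
        exact h1.le

/-! ### Goldstine's theorem and James' sequences. -/

/-- Goldstine's theorem: functionals on the dual of norm at most one are approximated, on finitely
many points, by elements of the unit ball. -/
theorem exists_norm_le_one_forall_abs_sub_lt {E : Type*} [NormedAddCommGroup E] [NormedSpace ℝ E]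
    {φ : StrongDual ℝ (StrongDual ℝ E)} (hφ : ‖φ‖ ≤ 1) (s : Finset (StrongDual ℝ E)) {ε : ℝ}
    (hε : 0 < ε) : ∃ x : E, ‖x‖ ≤ 1 ∧ ∀ f ∈ s, |f x - φ f| < ε := by
  classical
  let T : E →L[ℝ] (s → ℝ) := ContinuousLinearMap.pi fun f => f
  let p : s → ℝ := fun f => φ f
  have hp : p ∈ closure (T '' Metric.closedBall 0 1) := by
    by_contra hn
    obtain ⟨g, u, hgu, hu⟩ := geometric_hahn_banach_closed_point
      (((convex_closedBall (0 : E) 1).linear_image T.toLinearMap).closure) isClosed_closure hn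
    -- The separating functional on the finite product comes from `h` in the dual of `E`, and it
    -- would give `‖h‖ ≤ u < φ h ≤ ‖h‖`.
    let h : StrongDual ℝ E := ∑ f : s, g (Pi.single f 1) • (f : StrongDual ℝ E)
    have hg : ∀ a : s → ℝ, g a = ∑ f : s, g (Pi.single f 1) * a f := by
      intro a
      conv_lhs => rw [pi_eq_sum_univ' a, map_sum]
      refine Finset.sum_congr rfl fun f _ => ?_
      rw [map_smul, smul_eq_mul, mul_comm]
    have hh : ∀ x, h x = g (T x) := by
      intro x
      rw [hg]
      simp [h, T]
    have hφh : φ h = g p := by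
      rw [hg]
      simp [h, p]
    have hlt : ∀ x, ‖x‖ ≤ 1 → h x < u := fun x hx => by
      rw [hh]
      exact hgu _ (subset_closure ⟨x, by simpa using hx, rfl⟩)
    have hu0 : 0 ≤ u := by simpa using (hlt 0 (by simp)).le
    have hn : ‖h‖ ≤ u := ContinuousLinearMap.opNorm_le_of_unit_norm hu0 fun x hx => by
      rw [Real.norm_eq_abs, abs_le]
      have h1 := hlt x hx.le
      have h2 := hlt (-x) (by rw [norm_neg]; exact hx.le)
      rw [map_neg] at h2
      constructor <;> linarith
    have h1 : |φ h| ≤ 1 * ‖h‖ := φ.le_of_opNorm_le hφ h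
    have h2 := le_abs_self (φ h)
    linarith
  obtain ⟨_, ⟨x, hx, rfl⟩, hxp⟩ := Metric.mem_closure_iff.1 hp ε hε
  refine ⟨x, by simpa using hx, fun f hf => ?_⟩
  have := (dist_pi_lt_iff hε).1 hxp ⟨f, hf⟩
  rwa [Real.dist_eq, abs_sub_comm] at this

theorem norm_inv_norm_add_one_smul_le {E : Type*} [NormedAddCommGroup E] [NormedSpace ℝ E]
    (v : E) : ‖(‖v‖ + 1)⁻¹ • v‖ ≤ 1 := by
  rw [norm_smul, norm_inv, Real.norm_of_nonneg (by positivity), inv_mul_le_iff₀ (by positivity)]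
  linarith

theorem Submodule.exists_norm_le_one_strongDual {E : Type*} [NormedAddCommGroup E]
    [NormedSpace ℝ E] (p : Submodule ℝ E) (hp : IsClosed (p : Set E)) {x : E} (hx : x ∉ p) :
    ∃ (y : E) (f : StrongDual ℝ E), ‖y‖ ≤ 1 ∧ ‖f‖ ≤ 1 ∧ (∀ z ∈ p, f z = 0) ∧ 0 < f y := by
  obtain ⟨f, hf, hfx⟩ := p.exists_strongDual_eq_zero_of_notMem hp hx
  refine ⟨_, _, norm_inv_norm_add_one_smul_le x, norm_inv_norm_add_one_smul_le f,
    fun z hz => by simp [hf z hz], ?_⟩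
  rw [smul_apply, map_smul, smul_eq_mul, smul_eq_mul]
  positivity

/-- James' sequences in a non-reflexive Banach space, in an approximate form. -/
theorem exists_james_seq {E : Type*} [NormedAddCommGroup E] [NormedSpace ℝ E] [CompleteSpace E]
    (hE : ¬ IsReflexiveSpace E) : ∃ (d : ℝ) (f : ℕ → StrongDual ℝ E) (x : ℕ → E), 0 < d ∧
      (∀ n, ‖f n‖ ≤ 1) ∧ (∀ n, ‖x n‖ ≤ 1) ∧ (∀ j i, j ≤ i → d ≤ f j (x i)) ∧
      ∀ i j, i < j → |f j (x i)| ≤ d / 4 := by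
  classical
  let J := NormedSpace.inclusionInDoubleDualLi ℝ (E := E)
  have hJ : IsClosed (SetLike.coe (LinearMap.range J.toLinearMap)) :=
    J.isometry.isUniformInducing.isComplete_range.isClosed
  obtain ⟨φ₀, hφ₀⟩ := not_forall.1 hE
  obtain ⟨φ, ψ, hφ, hψ, hψJ₀, ht⟩ := Submodule.exists_norm_le_one_strongDual _ hJ (x := φ₀)
    (by rintro ⟨x, hx⟩; exact hφ₀ ⟨x, hx⟩)
  have hψJ : ∀ x, ψ (NormedSpace.inclusionInDoubleDual ℝ E x) = 0 := fun x => hψJ₀ _ ⟨x, rfl⟩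
  set t := ψ φ
  -- Here `ψ` kills the image of `E` in its bidual while `ψ φ = t > 0`. Each new `f` imitates `ψ` on
  -- `φ` and the earlier points, so it is small at those points; each new `x` imitates `φ` on all
  -- functionals chosen so far, so they are large at `x`.
  obtain ⟨y, hy, hyr⟩ := exists_seq_of_forall_finset_exists
    (fun y : StrongDual ℝ E × E => ‖y.1‖ ≤ 1 ∧ ‖y.2‖ ≤ 1 ∧ 7 * t / 8 ≤ φ y.1 ∧ t / 2 ≤ y.1 y.2)
    (fun y z => |z.1 y.2| ≤ t / 8 ∧ t / 2 ≤ y.1 z.2) (by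
    intro s hs
    obtain ⟨f, hf, hfa⟩ := exists_norm_le_one_forall_abs_sub_lt hψ
      (insert φ (s.image fun y => NormedSpace.inclusionInDoubleDual ℝ E y.2))
      (show 0 < t / 8 by positivity)
    have hφf := (abs_lt.1 (hfa φ (Finset.mem_insert_self _ _))).1
    have hfs : ∀ y ∈ s, |f y.2| < t / 8 := fun y hy => by
      simpa [hψJ] using hfa (NormedSpace.inclusionInDoubleDual ℝ E y.2)
        (Finset.mem_insert_of_mem (Finset.mem_image_of_mem _ hy))
    obtain ⟨x, hx, hxa⟩ := exists_norm_le_one_forall_abs_sub_lt hφ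
      (insert f (s.image Prod.fst)) (show 0 < t / 8 by positivity)
    refine ⟨(f, x), ⟨hf, hx, by linarith, ?_⟩, fun y hy => ⟨(hfs y hy).le, ?_⟩⟩
    · have := (abs_lt.1 (hxa f (Finset.mem_insert_self _ _))).1
      linarith
    · have := (abs_lt.1 (hxa y.1 (Finset.mem_insert_of_mem (Finset.mem_image_of_mem _ hy)))).1
      have := (hs y hy).2.2.1
      linarith)
  refine ⟨t / 2, fun n => (y n).1, fun n => (y n).2, by positivity, fun n => (hy n).1,
    fun n => (hy n).2.1, fun j i hji => ?_, fun i j hij => ?_⟩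
  · rcases hji.eq_or_lt with rfl | h
    · exact (hy _).2.2.2
    · exact (hyr _ _ h).2
  · have := (hyr _ _ hij).1
    linarith

/-! ### Pointwise convergent selections from decreasing convex sets. -/

section ConvexBlocks

variable {E : Type*} [NormedAddCommGroup E] [NormedSpace ℝ E]

/-- A decreasing sequence of nonempty convex subsets of the dual unit ball. -/
structure IsConvexNest (C : ℕ → Set (StrongDual ℝ E)) : Prop where
  antitone : Antitone C
  convex : ∀ n, Convex ℝ (C n)
  nonempty : ∀ n, (C n).Nonempty
  norm_le : ∀ n, ∀ f ∈ C n, ‖f‖ ≤ 1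

/-- `D` refines `C`: each term of `C` contains some term of `D`. -/
def NestRefines (D C : ℕ → Set (StrongDual ℝ E)) : Prop := ∀ n, ∃ m, D m ⊆ C n

theorem NestRefines.of_subset {D C : ℕ → Set (StrongDual ℝ E)} (h : ∀ n, D n ⊆ C n) :
    NestRefines D C := fun n => ⟨n, h n⟩

theorem NestRefines.trans {B C D : ℕ → Set (StrongDual ℝ E)} (h : NestRefines D C)
    (h' : NestRefines C B) : NestRefines D B := fun n => by
  obtain ⟨m, hm⟩ := h' n
  obtain ⟨k, hk⟩ := h m
  exact ⟨k, hk.trans hm⟩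

theorem NestRefines.exists_forall_subset {S : Finset (ℕ → Set (StrongDual ℝ E))}
    {C : ℕ → Set (StrongDual ℝ E)} (hS : ∀ D ∈ S, Antitone D) (hSC : ∀ D ∈ S, NestRefines D C)
    (n : ℕ) : ∃ m, ∀ D ∈ S, D m ⊆ C n := by
  choose! k hk using fun D hD => hSC D hD n
  exact ⟨S.sup k, fun D hD => (hS D hD (Finset.le_sup hD)).trans (hk D hD)⟩

/-- The asymptotic oscillation of the nest `C` on the unit ball is at most `r`. -/
def NestOscLE (C : ℕ → Set (StrongDual ℝ E)) (r : ℝ) : Prop :=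
  ∀ x : E, ‖x‖ ≤ 1 → ∃ n, ∀ f ∈ C n, ∀ g ∈ C n, f x - g x ≤ r

theorem NestOscLE.mono {C D : ℕ → Set (StrongDual ℝ E)} {r s : ℝ} (h : NestOscLE C r)
    (hDC : NestRefines D C) (hrs : r ≤ s) : NestOscLE D s := fun x hx => by
  obtain ⟨n, hn⟩ := h x hx
  obtain ⟨m, hm⟩ := hDC n
  exact ⟨m, fun f hf g hg => (hn f (hm hf) g (hm hg)).trans hrs⟩

theorem IsConvexNest.nestOscLE_two {C : ℕ → Set (StrongDual ℝ E)} (hC : IsConvexNest C) :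
    NestOscLE C 2 := fun x hx => by
  have key : ∀ f ∈ C 0, |f x| ≤ 1 := fun f hf =>
    (f.le_of_opNorm_le (hC.norm_le 0 f hf) x).trans (by simpa using hx)
  refine ⟨0, fun f hf g hg => ?_⟩
  have := abs_le.1 (key f hf)
  have := abs_le.1 (key g hg)
  linarith

/-- The diagonal intersections are nonempty because at stage `n` only finitely many nests occur, all
refined by the `n`-th. This is the σ-closedness needed by `exists_forall_decided`. -/
theorem exists_convexNest_lowerBound (u : ℕ → {C : ℕ → Set (StrongDual ℝ E) // IsConvexNest C})
    (hu : ∀ n, NestRefines (u (n + 1)).1 (u n).1) :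
    ∃ D : {C : ℕ → Set (StrongDual ℝ E) // IsConvexNest C}, ∀ n, NestRefines D.1 (u n).1 := by
  classical
  have hle : ∀ k n, k ≤ n → NestRefines (u n).1 (u k).1 := by
    intro k n hkn
    induction n, hkn using Nat.le_induction with
    | base => exact NestRefines.of_subset fun _ => subset_rfl
    | succ n _ ih => exact (hu n).trans ih
  refine ⟨⟨fun n => ⋂ k ≤ n, (u k).1 n, ?_, fun n => convex_iInter₂ fun k _ => (u k).2.convex n,
    fun n => ?_, fun n f hf => (u 0).2.norm_le n f (Set.mem_iInter₂.1 hf 0 (Nat.zero_le _))⟩,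
    fun k n => ⟨max k n, ?_⟩⟩
  · intro n m hnm f hf
    simp only [Set.mem_iInter] at hf ⊢
    exact fun k hk => (u k).2.antitone hnm (hf k (hk.trans hnm))
  · choose! m hm using fun k (hk : k ≤ n) => hle k n hk n
    obtain ⟨f, hf⟩ := (u n).2.nonempty ((Finset.range (n + 1)).sup m)
    refine ⟨f, Set.mem_iInter₂.2 fun k hk => hm k hk ((u n).2.antitone ?_ hf)⟩
    exact Finset.le_sup (f := m) (Finset.mem_range.2 (by omega))
  · intro f hf
    exact (u k).2.antitone (le_max_right _ _) (Set.mem_iInter₂.1 hf k (le_max_left _ _))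

/-- Every nest has a refinement whose oscillation is either zero or cannot be decreased by
passing to a further refinement. -/
theorem IsConvexNest.exists_minimal_osc {C : ℕ → Set (StrongDual ℝ E)} (hC : IsConvexNest C) :
    ∃ D, IsConvexNest D ∧ NestRefines D C ∧ ((∀ r > 0, NestOscLE D r) ∨
      ∃ ρ > 0, (∀ r > ρ, NestOscLE D r) ∧
        ∀ B, IsConvexNest B → NestRefines B D → ∀ r < ρ, ¬ NestOscLE B r) := by
  obtain ⟨e, he⟩ := exists_surjective_nat ℚ
  obtain ⟨⟨D, hD⟩, hDC, hdec⟩ := exists_forall_decided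
    (α := {C : ℕ → Set (StrongDual ℝ E) // IsConvexNest C}) (r := fun D C => NestRefines D.1 C.1)
    (fun _ => NestRefines.of_subset fun _ => subset_rfl) (fun _ _ _ h h' => h.trans h')
    exists_convexNest_lowerBound (fun k C => NestOscLE C.1 (e k))
    (fun _ _ _ h hq => hq.mono h le_rfl) ⟨C, hC⟩
  refine ⟨D, hD, hDC, ?_⟩
  by_cases h0 : ∀ r > 0, NestOscLE D r
  · exact Or.inl h0
  right
  push Not at h0
  obtain ⟨r₀, hr₀, hr₀D⟩ := h0
  let R : Set ℝ := {r | NestOscLE D r}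
  have hRb : ∀ r ∈ R, r₀ ≤ r := fun r hr => by
    by_contra! h
    exact hr₀D (NestOscLE.mono hr (NestRefines.of_subset fun _ => subset_rfl) h.le)
  have hRne : R.Nonempty := ⟨2, hD.nestOscLE_two⟩
  refine ⟨sInf R, hr₀.trans_le (le_csInf hRne hRb), fun r hr => ?_, fun B hB hBD r hr hBr => ?_⟩
  · obtain ⟨s, hs, hsr⟩ := exists_lt_of_csInf_lt hRne hr
    exact NestOscLE.mono hs (NestRefines.of_subset fun _ => subset_rfl) hsr.le
  · obtain ⟨q, hrq, hq⟩ := exists_rat_btwn hr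
    obtain ⟨k, rfl⟩ := he q
    rcases hdec k with h | h
    · exact hq.not_ge (csInf_le ⟨r₀, hRb⟩ h)
    · exact h ⟨B, hB⟩ hBD (hBr.mono (NestRefines.of_subset fun _ => subset_rfl) hrq.le)

/-- The averages of finitely many nests. -/
def nestAverage (S : Finset (ℕ → Set (StrongDual ℝ E))) (n : ℕ) : Set (StrongDual ℝ E) :=
  {f | ∃ c : (ℕ → Set (StrongDual ℝ E)) → StrongDual ℝ E, (∀ D ∈ S, c D ∈ D n) ∧
    f = ∑ D ∈ S, (S.card : ℝ)⁻¹ • c D}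

theorem nestAverage_subset {S : Finset (ℕ → Set (StrongDual ℝ E))} (hS : S.Nonempty) {n : ℕ}
    {K : Set (StrongDual ℝ E)} (hK : Convex ℝ K) (h : ∀ D ∈ S, D n ⊆ K) :
    nestAverage S n ⊆ K := by
  rintro _ ⟨c, hc, rfl⟩
  have : (S.card : ℝ) ≠ 0 := by exact_mod_cast hS.card_ne_zero
  exact hK.sum_mem (fun _ _ => by positivity) (by simp [this]) fun D hD => h D hD (hc D hD)

theorem isConvexNest_nestAverage {S : Finset (ℕ → Set (StrongDual ℝ E))} (hS : S.Nonempty)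
    (hSn : ∀ D ∈ S, IsConvexNest D) : IsConvexNest (nestAverage S) where
  antitone := by
    rintro n m hnm _ ⟨c, hc, rfl⟩
    exact ⟨c, fun D hD => (hSn D hD).antitone hnm (hc D hD), rfl⟩
  convex := by
    rintro n _ ⟨c, hc, rfl⟩ _ ⟨c', hc', rfl⟩ a b ha hb hab
    refine ⟨fun D => a • c D + b • c' D,
      fun D hD => (hSn D hD).convex n (hc D hD) (hc' D hD) ha hb hab, ?_⟩
    simp only [Finset.smul_sum, ← Finset.sum_add_distrib]
    refine Finset.sum_congr rfl fun D _ => ?_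
    rw [smul_add, smul_comm a, smul_comm b]
  nonempty := fun n => by
    choose! c hc using fun D hD => (hSn D hD).nonempty n
    exact ⟨_, c, hc, rfl⟩
  norm_le := fun n f hf => by
    have := nestAverage_subset hS (convex_closedBall (0 : StrongDual ℝ E) 1)
      (fun D hD g hg => by simpa using (hSn D hD).norm_le n g hg) hf
    simpa using this

/-- Finitely many refinements of a nest of minimal oscillation can be split simultaneously by one
point of the unit ball. -/
theorem IsConvexNest.exists_split {C : ℕ → Set (StrongDual ℝ E)} (hC : IsConvexNest C) {ρ : ℝ}
    (hρ : 0 < ρ) (hle : ∀ r > ρ, NestOscLE C r)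
    (hmin : ∀ B, IsConvexNest B → NestRefines B C → ∀ r < ρ, ¬ NestOscLE B r)
    {S : Finset (ℕ → Set (StrongDual ℝ E))} (hS : S.Nonempty) (hSn : ∀ D ∈ S, IsConvexNest D)
    (hSC : ∀ D ∈ S, NestRefines D C) :
    ∃ (x : E) (u d : ℝ), ‖x‖ ≤ 1 ∧ d + ρ / 2 ≤ u ∧
      ∀ D ∈ S, ∀ n, (∃ f ∈ D n, u ≤ f x) ∧ ∃ f ∈ D n, f x ≤ d := by
  set M : ℝ := (S.card : ℝ) with hM
  have hM1 : 1 ≤ M := Nat.one_le_cast.2 hS.card_pos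
  set ε : ℝ := ρ / (2 * (4 * M + 2)) with hε
  have hε0 : 0 < ε := by positivity
  have hερ : (4 * M + 2) * ε = ρ / 2 := by rw [hε]; field_simp
  have hsub := NestRefines.exists_forall_subset (fun D hD => (hSn D hD).antitone) hSC
  -- The average of the nests still oscillates by almost `ρ` at some `x`. No single nest can exceed
  -- `ρ` by much, so at this same `x` every one of them oscillates by almost `ρ`.
  have hA := hmin _ (isConvexNest_nestAverage hS hSn) (fun n => by
    obtain ⟨m, hm⟩ := hsub n
    exact ⟨m, nestAverage_subset hS (hC.convex n) hm⟩) (ρ - ε) (by linarith)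
  simp only [NestOscLE, not_forall, not_exists, not_le] at hA
  obtain ⟨x, hx, hA⟩ := hA
  obtain ⟨n₀, hn₀⟩ := hle (ρ + ε) (by linarith) x hx
  obtain ⟨N, hN⟩ := hsub n₀
  -- an almost minimal value of `x` on `C n₀`
  obtain ⟨b, hb, hbmin⟩ : ∃ b ∈ C n₀, ∀ g ∈ C n₀, b x ≤ g x + ε := by
    obtain ⟨f₀, hf₀⟩ := hC.nonempty n₀
    obtain ⟨_, ⟨b, hb, rfl⟩, hlt⟩ := Real.lt_sInf_add_pos
      (s := (fun g : StrongDual ℝ E => g x) '' C n₀) ⟨_, f₀, hf₀, rfl⟩ hε0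
    refine ⟨b, hb, fun g hg => hlt.le.trans ?_⟩
    have hbdd : BddBelow ((fun g : StrongDual ℝ E => g x) '' C n₀) := by
      refine ⟨f₀ x - (ρ + ε), ?_⟩
      rintro _ ⟨g, hg, rfl⟩
      have := hn₀ f₀ hf₀ g hg
      dsimp only
      linarith
    have := csInf_le hbdd ⟨g, hg, rfl⟩
    dsimp only at this
    linarith
  have key : ∀ D ∈ S, ∀ n, ∃ f ∈ D n, ∃ g ∈ D n, f ∈ C n₀ ∧ g ∈ C n₀ ∧
      ρ - 2 * M * ε ≤ f x - g x := by
    intro D hD n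
    obtain ⟨_, ⟨c, hc, rfl⟩, _, ⟨c', hc', rfl⟩, hlt⟩ := hA (max n N)
    have hin : ∀ B ∈ S, ∀ f ∈ B (max n N), f ∈ C n₀ := fun B hB f hf =>
      hN B hB ((hSn B hB).antitone (le_max_right _ _) hf)
    have hn : D (max n N) ⊆ D n := (hSn D hD).antitone (le_max_left _ _)
    refine ⟨c D, hn (hc D hD), c' D, hn (hc' D hD), hin D hD _ (hc D hD),
      hin D hD _ (hc' D hD), ?_⟩
    have h1 : M * (ρ - ε) < ∑ B ∈ S, (c B x - c' B x) := by
      simp only [sum_apply, smul_apply, smul_eq_mul, ← Finset.mul_sum, ← mul_sub,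
        ← Finset.sum_sub_distrib] at hlt
      rwa [← div_eq_inv_mul, lt_div_iff₀ (by positivity), mul_comm] at hlt
    classical
    rw [← Finset.add_sum_erase _ _ hD] at h1
    have h2 : ∑ B ∈ S.erase D, (c B x - c' B x) ≤ (M - 1) * (ρ + ε) := by
      have := Finset.sum_le_card_nsmul (S.erase D) (fun B => c B x - c' B x) (ρ + ε)
        fun B hB => by
          have hB := Finset.mem_of_mem_erase hB
          exact hn₀ _ (hin B hB _ (hc B hB)) _ (hin B hB _ (hc' B hB))
      rw [Finset.card_erase_of_mem hD, nsmul_eq_mul, Nat.cast_pred hS.card_pos] at this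
      exact this
    nlinarith
  -- All values lie in an interval of length about `ρ` starting near `b x`, so two values almost `ρ`
  -- apart lie near its two ends. This makes the thresholds independent of the nest.
  refine ⟨x, b x + ρ - 2 * M * ε - ε, b x + (2 * M + 1) * ε, hx, by nlinarith,
    fun D hD n => ?_⟩
  obtain ⟨f, hf, g, hg, hfC, hgC, hfg⟩ := key D hD n
  refine ⟨⟨f, hf, ?_⟩, g, hg, ?_⟩
  · have := hbmin g hgC
    linarith
  · have := hn₀ f hfC b hb
    linarith

theorem IsConvexNest.inter {D : ℕ → Set (StrongDual ℝ E)} (hD : IsConvexNest D)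
    {K : Set (StrongDual ℝ E)} (hK : Convex ℝ K) (h : ∀ n, (D n ∩ K).Nonempty) :
    IsConvexNest fun n => D n ∩ K :=
  ⟨fun _ _ hnm => Set.inter_subset_inter_left _ (hD.antitone hnm),
    fun n => (hD.convex n).inter hK, h, fun n f hf => hD.norm_le n f hf.1⟩

/-- A nest whose oscillation is positive and cannot be decreased yields an `ℓ¹` sequence. -/
theorem IsConvexNest.exists_isEllOneSeq {C : ℕ → Set (StrongDual ℝ E)} (hC : IsConvexNest C)
    {ρ : ℝ} (hρ : 0 < ρ) (hle : ∀ r > ρ, NestOscLE C r)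
    (hmin : ∀ B, IsConvexNest B → NestRefines B C → ∀ r < ρ, ¬ NestOscLE B r) :
    ∃ x : ℕ → E, IsEllOneSeq x := by
  classical
  let T := {S : Finset (ℕ → Set (StrongDual ℝ E)) //
    S.Nonempty ∧ (∀ D ∈ S, IsConvexNest D) ∧ ∀ D ∈ S, NestRefines D C}
  choose X U V hX hUV hsplit using fun S : T =>
    hC.exists_split hρ hle hmin S.2.1 S.2.2.1 S.2.2.2
  let up : T → (ℕ → Set (StrongDual ℝ E)) → ℕ → Set (StrongDual ℝ E) :=
    fun S D n => D n ∩ {f | U S ≤ f (X S)}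
  let lo : T → (ℕ → Set (StrongDual ℝ E)) → ℕ → Set (StrongDual ℝ E) :=
    fun S D n => D n ∩ {f | f (X S) ≤ V S}
  have hup : ∀ (S : T), ∀ D ∈ S.1, IsConvexNest (up S D) := fun S D hD =>
    (S.2.2.1 D hD).inter (convex_halfSpace_ge ⟨fun _ _ => rfl, fun _ _ => rfl⟩ _)
      fun n => (hsplit S D hD n).1
  have hlo : ∀ (S : T), ∀ D ∈ S.1, IsConvexNest (lo S D) := fun S D hD =>
    (S.2.2.1 D hD).inter (convex_halfSpace_le ⟨fun _ _ => rfl, fun _ _ => rfl⟩ _)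
      fun n => (hsplit S D hD n).2
  -- Each stage replaces every nest by its upper and lower halves. The nests form a binary tree, and
  -- one point splits a whole level.
  let next : T → T := fun S => ⟨S.1.image (up S) ∪ S.1.image (lo S),
    (S.2.1.image _).inl, fun D hD => by
      rcases Finset.mem_union.1 hD with h | h <;> obtain ⟨B, hB, rfl⟩ := Finset.mem_image.1 h
      exacts [hup S B hB, hlo S B hB], fun D hD => by
      rcases Finset.mem_union.1 hD with h | h <;> obtain ⟨B, hB, rfl⟩ := Finset.mem_image.1 h <;>
      exact (NestRefines.of_subset fun _ => Set.inter_subset_left).trans (S.2.2.2 B hB)⟩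
  let S : ℕ → T := fun n => Nat.rec ⟨{C}, Finset.singleton_nonempty _, by simpa using hC,
    by simpa using NestRefines.of_subset fun _ => subset_rfl⟩ (fun _ => next) n
  refine ⟨fun n => X (S n), IsEllOneSeq.of_independent (fun n => hX (S n)) (half_pos hρ)
    (u := fun n => U (S n)) (d := fun n => V (S n)) (fun n => hUV _) fun s m => ?_⟩
  -- The branch of the tree prescribed by `s`; any functional in its `m`-th nest realises the first
  -- `m` signs.
  let D : ℕ → ℕ → Set (StrongDual ℝ E) := fun n =>
    Nat.rec C (fun k B => if k ∈ s then up (S k) B else lo (S k) B) n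
  have hD : ∀ n, D (n + 1) = if n ∈ s then up (S n) (D n) else lo (S n) (D n) := fun _ => rfl
  have hDS : ∀ n, D n ∈ (S n).1 := by
    intro n
    induction n with
    | zero => exact Finset.mem_singleton_self C
    | succ n ih =>
      rw [hD]
      split_ifs
      · exact Finset.mem_union_left _ (Finset.mem_image_of_mem _ ih)
      · exact Finset.mem_union_right _ (Finset.mem_image_of_mem _ ih)
  obtain ⟨f, hf⟩ := ((S m).2.2.1 _ (hDS m)).nonempty 0
  refine ⟨f, ((S m).2.2.1 _ (hDS m)).norm_le 0 f hf, ?_⟩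
  clear_value S
  induction m with
  | zero => exact fun i hi => absurd hi (Nat.not_lt_zero i)
  | succ m ih =>
    rw [hD] at hf
    have hf' : f ∈ D m 0 := by
      split_ifs at hf
      exacts [hf.1, hf.1]
    intro i hi
    rcases Nat.lt_succ_iff_lt_or_eq.1 hi with h | rfl
    · exact ih hf' i h
    · refine ⟨fun h => ?_, fun h => ?_⟩
      · rw [if_pos h] at hf
        exact hf.2
      · rw [if_neg h] at hf
        exact hf.2

/-- If `E` contains no `ℓ¹` sequence, then from a decreasing sequence of nonempty convex subsets of
the dual ball one can select a pointwise convergent sequence. -/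
theorem IsConvexNest.exists_tendsto (hE : ∀ x : ℕ → E, ¬ IsEllOneSeq x)
    {C : ℕ → Set (StrongDual ℝ E)} (hC : IsConvexNest C) :
    ∃ h : ℕ → StrongDual ℝ E, (∀ n, h n ∈ C n) ∧
      ∀ x, ∃ l : ℝ, Tendsto (fun n => h n x) atTop (𝓝 l) := by
  obtain ⟨D, hD, hDC, h | ⟨ρ, hρ, hle, hmin⟩⟩ := hC.exists_minimal_osc
  swap
  · obtain ⟨x, hx⟩ := hD.exists_isEllOneSeq hρ hle hmin
    exact absurd hx (hE x)
  choose m hm using hDC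
  choose h₀ hh₀ using fun n => hD.nonempty (max n (m n))
  refine ⟨h₀, fun n => hm n (hD.antitone (le_max_right _ _) (hh₀ n)), fun x => ?_⟩
  have hmem : ∀ N n, N ≤ n → h₀ n ∈ D N := fun N n hn =>
    hD.antitone (hn.trans (le_max_left _ _)) (hh₀ n)
  have hball : ∀ x : E, ‖x‖ ≤ 1 → ∃ l : ℝ, Tendsto (fun n => h₀ n x) atTop (𝓝 l) := by
    intro x hx
    refine cauchySeq_tendsto_of_complete (Metric.cauchySeq_iff.2 fun ε hε => ?_)
    obtain ⟨N, hN⟩ := h (ε / 2) (half_pos hε) x hx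
    refine ⟨N, fun a ha b hb => ?_⟩
    have h1 := hN _ (hmem N a ha) _ (hmem N b hb)
    have h2 := hN _ (hmem N b hb) _ (hmem N a ha)
    rw [Real.dist_eq, abs_lt]
    constructor <;> linarith
  obtain ⟨l, hl⟩ := hball _ (norm_inv_norm_add_one_smul_le x)
  refine ⟨(‖x‖ + 1) * l, (hl.const_mul (‖x‖ + 1)).congr fun n => ?_⟩
  have : ‖x‖ + 1 ≠ 0 := by positivity
  simp [this]

end ConvexBlocks

/-! ### Hereditary Cesàro convergence under the Banach–Saks property. -/

section BanachSaks

variable {E : Type*} [NormedAddCommGroup E] [NormedSpace ℝ E]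

theorem cesaroTendsto_zero_iff {u : ℕ → E} : CesaroTendsto u 0 ↔
    ∀ ε > 0, ∀ᶠ n : ℕ in atTop, ‖∑ i ∈ Finset.range n, u i‖ ≤ ε * n := by
  have hnorm : ∀ n : ℕ, 0 < n → ∀ ε : ℝ, ‖(n : ℝ)⁻¹ • ∑ i ∈ Finset.range n, u i‖ ≤ ε ↔
      ‖∑ i ∈ Finset.range n, u i‖ ≤ ε * n := by
    intro n hn ε
    have : (0 : ℝ) < n := by exact_mod_cast hn
    rw [norm_smul, norm_inv, Real.norm_of_nonneg this.le, inv_mul_le_iff₀ this, mul_comm]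
  rw [CesaroTendsto, NormedAddGroup.tendsto_nhds_zero]
  constructor
  · intro h ε hε
    filter_upwards [h ε hε, eventually_gt_atTop 0] with n hn h0
    exact (hnorm n h0 ε).1 hn.le
  · intro h ε hε
    filter_upwards [h (ε / 2) (half_pos hε), eventually_gt_atTop 0] with n hn h0
    exact ((hnorm n h0 _).2 hn).trans_lt (half_lt_self hε)

theorem HasBanachSaksProperty.exists_subseq (hE : HasBanachSaksProperty E) {u : ℕ → E} {C : ℝ}
    (hu : ∀ n, ‖u n‖ ≤ C) :
    ∃ φ : ℕ → ℕ, StrictMono φ ∧ ∃ l : E, CesaroTendsto (fun n => u (φ n)) l := by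
  have hC : 0 < C + 1 := by linarith [(norm_nonneg _).trans (hu 0)]
  obtain ⟨φ, hφ, l, hl⟩ := hE (fun n => (C + 1)⁻¹ • u n) fun n => by
    rw [mem_closedBall_zero_iff, norm_smul, norm_inv, Real.norm_of_nonneg hC.le,
      inv_mul_le_iff₀ hC]
    linarith [hu n]
  refine ⟨φ, hφ, (C + 1) • l, (hl.const_smul (C + 1)).congr fun n => ?_⟩
  rw [← Finset.smul_sum, smul_comm, smul_inv_smul₀ hC.ne']

theorem StrictMono.exists_eq_comp {a χ : ℕ → ℕ} (ha : StrictMono a) (hχ : StrictMono χ)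
    (h : ∀ i, a i ∈ Set.range χ) : ∃ ψ : ℕ → ℕ, StrictMono ψ ∧ a = χ ∘ ψ := by
  choose ψ hψ using h
  exact ⟨ψ, fun i j hij => hχ.lt_iff_lt.1 (by rw [hψ, hψ]; exact ha hij),
    funext fun i => (hψ i).symm⟩

theorem norm_sum_range_add_le {E : Type*} [NormedAddCommGroup E] (v : ℕ → E) (p n : ℕ) :
    ‖∑ i ∈ Finset.range n, v (i + p)‖ ≤
      ‖∑ i ∈ Finset.range (n + p), v i‖ + ‖∑ i ∈ Finset.range p, v i‖ := by
  have : ∑ i ∈ Finset.range n, v (i + p) =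
      ∑ i ∈ Finset.range (n + p), v i - ∑ i ∈ Finset.range p, v i := by
    rw [add_comm n p, Finset.sum_range_add, add_sub_cancel_left]
    simp only [add_comm]
  rw [this]
  exact norm_sub_le _ _

/-- If every Cesàro convergent subsequence of a bounded sequence `u` in a space with the
Banach-Saks property has limit zero, then some subsequence of `u` has uniformly small means along
all its subsequences. -/
theorem HasBanachSaksProperty.exists_subseq_forall_norm_le (hE : HasBanachSaksProperty E)
    {u : ℕ → E} {C : ℝ} (hu : ∀ n, ‖u n‖ ≤ C)
    (h0 : ∀ φ : ℕ → ℕ, StrictMono φ → ∀ l, CesaroTendsto (fun n => u (φ n)) l → l = 0)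
    {ε : ℝ} (hε : 0 < ε) : ∃ φ : ℕ → ℕ, StrictMono φ ∧ ∃ k : ℕ, ∀ ψ : ℕ → ℕ, StrictMono ψ →
      ∀ n ≥ k, ‖∑ i ∈ Finset.range n, u (φ (ψ i))‖ ≤ ε * n := by
  by_contra! hcon
  have step : ∀ (k : ℕ) (χ : {χ : ℕ → ℕ // StrictMono χ}), ∃ χ' : {χ : ℕ → ℕ // StrictMono χ},
      Set.range χ'.1 ⊆ Set.range χ.1 ∧ ∀ ψ : ℕ → ℕ, StrictMono ψ →
        ∃ n ≥ k, ε * n < ‖∑ i ∈ Finset.range n, u (χ'.1 (ψ i))‖ := by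
    rintro k ⟨χ, hχ⟩
    -- A large mean at one `n` involves only `n` terms, so the property is open; `hcon` excludes the
    -- second alternative.
    obtain ⟨φ, hφ, h | h⟩ := exists_homogeneous_subseq
      (fun a => ∃ n ≥ k, ε * n < ‖∑ i ∈ Finset.range n, u (χ (a i))‖) (by
      rintro a - ⟨n, hn, h⟩
      refine ⟨n, fun b _ hb => ⟨n, hn, ?_⟩⟩
      rwa [Finset.sum_congr rfl fun i hi => by rw [hb i (Finset.mem_range.1 hi)]])
    · exact ⟨⟨χ ∘ φ, hχ.comp hφ⟩, Set.range_comp_subset_range φ χ, h⟩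
    · obtain ⟨ψ, hψ, n, hn, hlt⟩ := hcon (χ ∘ φ) (hχ.comp hφ) k
      exact absurd ⟨n, hn, hlt⟩ (h ψ hψ)
  choose F hFsub hF using step
  let χ : ℕ → {χ : ℕ → ℕ // StrictMono χ} := fun n =>
    Nat.rec ⟨id, strictMono_id⟩ (fun k χ => F (k + 1) χ) n
  have hχsub : Antitone fun n => Set.range (χ n).1 :=
    antitone_nat_of_succ_le fun n => hFsub (n + 1) (χ n)
  have hχ : ∀ k, ∀ ψ : ℕ → ℕ, StrictMono ψ →
      ∃ n ≥ k + 1, ε * n < ‖∑ i ∈ Finset.range n, u ((χ (k + 1)).1 (ψ i))‖ :=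
    fun k => hF (k + 1) (χ k)
  have hpick : ∀ i b : ℕ, ∃ b' ∈ Set.range (χ i).1, b < b' := fun i b =>
    (Set.infinite_range_of_injective (χ i).2.injective).exists_gt b
  choose G hGmem hGlt using hpick
  let a : ℕ → ℕ := fun n => Nat.rec (G 0 0) (fun k b => G (k + 1) b) n
  have ha : StrictMono a := strictMono_nat_of_lt_succ fun n => hGlt (n + 1) (a n)
  have hamem : ∀ i, a i ∈ Set.range (χ i).1 := fun i => by
    cases i with
    | zero => exact hGmem 0 0
    | succ i => exact hGmem (i + 1) (a i)
  obtain ⟨φ, hφ, l, hl⟩ := hE.exists_subseq (u := u ∘ a) fun n => hu _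
  obtain rfl := h0 (a ∘ φ) (ha.comp hφ) l hl
  obtain ⟨N, hN⟩ := eventually_atTop.1 (cesaroTendsto_zero_iff.1 hl (ε / 4) (by positivity))
  -- Dropping `N + 1` terms of the diagonal sequence leaves a subsequence of `χ (N + 1)`, which has
  -- a large mean at some `n ≥ N + 1`. As `n` dominates the number of dropped terms, the sum is at
  -- most `3 / 4 * ε * n`.
  obtain ⟨ψ, hψ, hψa⟩ := StrictMono.exists_eq_comp (a := fun i => a (φ (i + (N + 1))))
    (fun i j hij => ha (hφ (by omega))) (χ (N + 1)).2
    fun i => hχsub (show N + 1 ≤ φ (i + (N + 1)) from (Nat.le_add_left _ _).trans (hφ.id_le _))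
      (hamem _)
  obtain ⟨n, hn, hlt⟩ := hχ N ψ hψ
  have h1 := norm_sum_range_add_le (fun i => u (a (φ i))) (N + 1) n
  have h2 := hN (n + (N + 1)) (by omega)
  have h3 := hN (N + 1) (by omega)
  have h4 : ∀ i, (χ (N + 1)).1 (ψ i) = a (φ (i + (N + 1))) := fun i => (congrFun hψa i).symm
  simp only [h4] at hlt
  simp only [Function.comp_apply] at h2 h3
  have h5 : ((N + 1 : ℕ) : ℝ) ≤ n := by exact_mod_cast hn
  have h6 : (0 : ℝ) < ((N + 1 : ℕ) : ℝ) := by positivity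
  push_cast at h2 h3 h5 h6
  nlinarith

/-- The Erdős-Magidor theorem in a space with the Banach-Saks property: a bounded sequence all of
whose Cesàro limits are zero has a subsequence whose subsequences are all Cesàro null. -/
theorem HasBanachSaksProperty.exists_subseq_forall_cesaroTendsto (hE : HasBanachSaksProperty E)
    {u : ℕ → E} {C : ℝ} (hu : ∀ n, ‖u n‖ ≤ C)
    (h0 : ∀ φ : ℕ → ℕ, StrictMono φ → ∀ l, CesaroTendsto (fun n => u (φ n)) l → l = 0) :
    ∃ φ : ℕ → ℕ, StrictMono φ ∧ ∀ ψ : ℕ → ℕ, StrictMono ψ →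
      CesaroTendsto (fun n => u (φ (ψ n))) 0 := by
  obtain ⟨B, -, hB, hdec⟩ := Set.infinite_univ.exists_forall_decided
    (fun k A => ∀ a : ℕ → ℕ, StrictMono a → (∀ᶠ i in atTop, a i ∈ A) →
      ∀ᶠ n : ℕ in atTop, ‖∑ i ∈ Finset.range n, u (a i)‖ ≤ 1 / ((k : ℝ) + 1) * n) (by
    rintro k A B - hBA hA a ha haB
    refine hA a ha ?_
    have : ∀ᶠ i in atTop, a i ∉ B \ A :=
      ha.tendsto_atTop.eventually (Nat.cofinite_eq_atTop ▸ hBA.compl_mem_cofinite)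
    filter_upwards [haB, this] with i h1 h2
    by_contra h
    exact h2 ⟨h1, h⟩)
  have hν : StrictMono (Nat.nth (· ∈ B)) := Nat.nth_strictMono hB
  set ν := Nat.nth (· ∈ B) with hνdef
  have hνB : ∀ i, ν i ∈ B := fun n => Nat.nth_mem_of_infinite hB n
  refine ⟨ν, hν, fun ψ hψ => cesaroTendsto_zero_iff.2 fun ε hε => ?_⟩
  obtain ⟨k, hk⟩ := exists_nat_one_div_lt hε
  have hQ := (hdec k).resolve_right fun hneg => by
    have hk0 : (0 : ℝ) < 1 / ((k : ℝ) + 1) := by positivity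
    set δ : ℝ := 1 / ((k : ℝ) + 1)
    -- Half of the tolerance is spent on the subsequence; the other half absorbs the finitely many
    -- initial terms outside its range.
    obtain ⟨φ, hφ, m, hm⟩ := hE.exists_subseq_forall_norm_le (u := u ∘ ν) (fun n => hu _)
      (fun χ hχ => h0 (ν ∘ χ) (hν.comp hχ)) (half_pos hk0)
    refine hneg (Set.range (ν ∘ φ)) (Set.infinite_range_of_injective (hν.comp hφ).injective) ?_ ?_
    · have : Set.range (ν ∘ φ) ⊆ B := by rintro _ ⟨i, rfl⟩; exact hνB _
      simp [Set.sdiff_eq_empty.2 this]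
    · intro a ha haφ
      obtain ⟨p, hp⟩ := eventually_atTop.1 haφ
      obtain ⟨χ, hχ, hχa⟩ := StrictMono.exists_eq_comp (a := fun i => a (i + p))
        (fun i j hij => ha (by omega)) (hν.comp hφ) fun i => hp _ (by omega)
      have hlin : ∀ᶠ n : ℕ in atTop, 2 * (p * C) / δ ≤ n :=
        tendsto_natCast_atTop_atTop.eventually_ge_atTop _
      filter_upwards [hlin, eventually_ge_atTop (m + p)] with n hn hnp
      obtain ⟨j, rfl⟩ : ∃ j, n = p + j := ⟨n - p, by omega⟩
      rw [Finset.sum_range_add]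
      have h1 : ‖∑ i ∈ Finset.range p, u (a i)‖ ≤ p * C := by
        refine (norm_sum_le_of_le _ fun i _ => hu (a i)).trans_eq ?_
        simp
      have h2 : ‖∑ i ∈ Finset.range j, u (a (p + i))‖ ≤ δ / 2 * j := by
        have h3 : ∀ i, a (p + i) = ν (φ (χ i)) := fun i => by
          rw [add_comm]; exact congrFun hχa i
        simp only [h3]
        exact hm χ hχ j (by omega)
      rw [div_le_iff₀ hk0] at hn
      have h4 := norm_add_le (∑ i ∈ Finset.range p, u (a i)) (∑ i ∈ Finset.range j, u (a (p + i)))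
      push_cast at hn ⊢
      have h5 : (0 : ℝ) ≤ p := Nat.cast_nonneg p
      nlinarith
  filter_upwards [hQ (ν ∘ ψ) (hν.comp hψ) (Eventually.of_forall fun i => hνB _)] with n hn
  exact hn.trans (by gcongr)

end BanachSaks

/-! ### Weakly compact sets and the Mackey topology. -/

section Mackey

variable {X : Type*} [NormedAddCommGroup X] [NormedSpace ℝ X]

theorem cesaroTendsto_toMackeyDual_iff {f : ℕ → StrongDual ℝ X} :
    CesaroTendsto (fun n => toMackeyDual (f n)) (0 : MackeyDual X) ↔
      ∀ K ∈ weaklyCompactSets X, ∀ ε > 0, ∀ᶠ n : ℕ in atTop, ∀ x ∈ K,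
        |((n : ℝ)⁻¹ • ∑ i ∈ Finset.range n, f i) x| < ε := by
  have hsum : ∀ n : ℕ, (n : ℝ)⁻¹ • ∑ i ∈ Finset.range n, toMackeyDual (f i) =
      toMackeyDual ((n : ℝ)⁻¹ • ∑ i ∈ Finset.range n, f i) := fun n => rfl
  rw [CesaroTendsto, UniformConvergenceCLM.tendsto_iff_tendstoUniformlyOn]
  simp only [hsum, Metric.tendstoUniformlyOn_iff]
  refine forall₂_congr fun K _ => forall₂_congr fun ε _ => eventually_congr
    (Eventually.of_forall fun n => forall₂_congr fun x _ => ?_)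
  rw [dist_comm, Real.dist_eq]
  change |_ - (0 : ℝ)| < ε ↔ _
  rw [sub_zero]
  rfl

/-- Uniform boundedness in the bidual: each functional is bounded on a weakly compact set. -/
theorem exists_forall_norm_le_of_mem_weaklyCompactSets {K : Set X}
    (hK : K ∈ weaklyCompactSets X) : ∃ C, ∀ x ∈ K, ‖x‖ ≤ C := by
  obtain ⟨C, hC⟩ := banach_steinhaus (g := fun x : K =>
    NormedSpace.inclusionInDoubleDual ℝ X x) fun f => by
    have hcont : Continuous fun x : WeakSpace ℝ X => f ((toWeakSpace ℝ X).symm x) :=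
      WeakBilin.eval_continuous _ f
    obtain ⟨C, hC⟩ := (IsCompact.image hK hcont).isBounded.exists_norm_le
    exact ⟨C, fun x => hC _ ⟨_, ⟨x, x.2, rfl⟩, rfl⟩⟩
  refine ⟨C, fun x hx => ?_⟩
  rw [← (NormedSpace.inclusionInDoubleDualLi ℝ (E := X)).norm_map x]
  exact hC ⟨x, hx⟩

theorem CesaroTendsto.toMackeyDual {f : ℕ → StrongDual ℝ X} (hf : CesaroTendsto f 0) :
    CesaroTendsto (fun n => toMackeyDual (f n)) (0 : MackeyDual X) := by
  refine cesaroTendsto_toMackeyDual_iff.2 fun K hK ε hε => ?_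
  obtain ⟨C, hC⟩ := exists_forall_norm_le_of_mem_weaklyCompactSets hK
  have hC' : 0 < |C| + 1 := by positivity
  filter_upwards [NormedAddGroup.tendsto_nhds_zero.1 hf (ε / (|C| + 1)) (by positivity)]
    with n hn x hx
  rw [lt_div_iff₀ hC'] at hn
  refine (((n : ℝ)⁻¹ • ∑ i ∈ Finset.range n, f i).le_opNorm x).trans_lt (lt_of_le_of_lt ?_ hn)
  gcongr
  linarith [hC x hx, le_abs_self C]

/-- Banach–Alaoglu in the bidual, pulled back along the canonical embedding, which is onto. -/
theorem IsReflexiveSpace.closedBall_mem_weaklyCompactSets (hX : IsReflexiveSpace X) :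
    Metric.closedBall (0 : X) 1 ∈ weaklyCompactSets X := by
  have hcpt := WeakDual.isCompact_closedBall (𝕜 := ℝ) (0 : StrongDual ℝ (StrongDual ℝ X)) 1
  have := (NormedSpace.isEmbedding_inclusionInDoubleDualWeak ℝ X).isCompact_preimage' hcpt
    fun φ _ => by
      obtain ⟨x, hx⟩ := hX (WeakDual.toStrongDual φ)
      exact ⟨toWeakSpace ℝ X x, congrArg StrongDual.toWeakDual hx⟩
  rw [weaklyCompactSets, Set.mem_ofPred_eq]
  convert this using 1
  ext w
  have hw : ‖NormedSpace.inclusionInDoubleDual ℝ X ((toWeakSpace ℝ X).symm w)‖ =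
      ‖(toWeakSpace ℝ X).symm w‖ := (NormedSpace.inclusionInDoubleDualLi ℝ (E := X)).norm_map _
  constructor
  · rintro ⟨x, hx, rfl⟩
    rw [Set.mem_preimage, Set.mem_preimage, mem_closedBall_zero_iff]
    exact hw.trans_le (by simpa using hx)
  · intro h
    rw [Set.mem_preimage, Set.mem_preimage, mem_closedBall_zero_iff] at h
    exact ⟨(toWeakSpace ℝ X).symm w, by rw [mem_closedBall_zero_iff, ← hw]; exact h, by simp⟩

theorem IsReflexiveSpace.cesaroTendsto_of_toMackeyDual (hX : IsReflexiveSpace X)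
    {f : ℕ → StrongDual ℝ X} (hf : CesaroTendsto (fun n => toMackeyDual (f n)) (0 : MackeyDual X)) :
    CesaroTendsto f 0 := by
  refine NormedAddGroup.tendsto_nhds_zero.2 fun ε hε => ?_
  filter_upwards [cesaroTendsto_toMackeyDual_iff.1 hf _ hX.closedBall_mem_weaklyCompactSets
    (ε / 2) (half_pos hε)] with n hn
  refine lt_of_le_of_lt ?_ (half_lt_self hε)
  exact ContinuousLinearMap.opNorm_le_of_unit_norm (half_pos hε).le fun x hx =>
    (hn x (by simp [hx])).le

theorem insert_zero_range_mem_weaklyCompactSets {y : ℕ → X}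
    (hy : ∀ f : StrongDual ℝ X, Tendsto (fun n => f (y n)) atTop (𝓝 0)) :
    insert 0 (Set.range y) ∈ weaklyCompactSets X := by
  have h : Tendsto (fun n => toWeakSpace ℝ X (y n)) atTop (𝓝 (toWeakSpace ℝ X 0)) := by
    refine (WeakBilin.isEmbedding ?_).tendsto_nhds_iff.2 (tendsto_pi_nhds.2 fun f => ?_)
    · intro a b hab
      exact (NormedSpace.inclusionInDoubleDualLi ℝ (E := X)).injective
        (ContinuousLinearMap.ext fun f => LinearMap.congr_fun hab f)
    · have := hy f
      rw [← map_zero f] at this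
      exact this
  have := h.isCompact_insert_range
  rw [weaklyCompactSets, Set.mem_ofPred_eq, Set.image_insert_eq, ← Set.range_comp]
  exact this

theorem IsReflexiveSpace.strongDual (hX : IsReflexiveSpace X) :
    IsReflexiveSpace (StrongDual ℝ X) := by
  intro ψ
  refine ⟨ψ.comp (NormedSpace.inclusionInDoubleDual ℝ X), ?_⟩
  ext φ
  obtain ⟨x, rfl⟩ := hX φ
  rfl

end Mackey

/-! ### The implications. -/

section Main

variable {X : Type*} [NormedAddCommGroup X] [NormedSpace ℝ X]

theorem tendsto_toWeakDual_zero_iff {f : ℕ → StrongDual ℝ X} :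
    Tendsto (fun n => StrongDual.toWeakDual (f n)) atTop (𝓝 (0 : WeakDual ℝ X)) ↔
      ∀ x, Tendsto (fun n => f n x) atTop (𝓝 0) :=
  tendsto_iff_forall_eval_tendsto_topDualPairing

theorem CesaroTendsto.apply {f : ℕ → StrongDual ℝ X} {l : StrongDual ℝ X}
    (hf : CesaroTendsto f l) (x : X) : CesaroTendsto (fun n => f n x) (l x) := by
  refine (((NormedSpace.inclusionInDoubleDual ℝ X x).continuous.tendsto l).comp hf).congr
    fun n => ?_
  simp

theorem CesaroTendsto.eq_of_tendsto {u : ℕ → ℝ} {l l' : ℝ} (h : CesaroTendsto u l)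
    (h' : Tendsto u atTop (𝓝 l')) : l = l' :=
  tendsto_nhds_unique h h'.cesaro_smul

theorem CesaroTendsto.add_const {E : Type*} [NormedAddCommGroup E] [NormedSpace ℝ E] {u : ℕ → E}
    {l : E} (h : CesaroTendsto u l) (v : E) : CesaroTendsto (fun n => u n + v) (l + v) := by
  refine (Tendsto.add h (tendsto_const_nhds (x := v))).congr' ?_
  filter_upwards [eventually_gt_atTop 0] with n hn
  have : (n : ℝ) ≠ 0 := by exact_mod_cast hn.ne'
  rw [Finset.sum_add_distrib, smul_add, Finset.sum_const, Finset.card_range,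
    ← Nat.cast_smul_eq_nsmul ℝ, inv_smul_smul₀ this]

theorem le_inv_smul_sum_range {u : ℕ → ℝ} {n : ℕ} (hn : 0 < n) {c : ℝ}
    (h : ∀ i < n, c ≤ u i) : c ≤ (n : ℝ)⁻¹ * ∑ i ∈ Finset.range n, u i := by
  have hn' : (0 : ℝ) < n := by exact_mod_cast hn
  rw [← div_eq_inv_mul, le_div_iff₀ hn', mul_comm]
  simpa using Finset.card_nsmul_le_sum (Finset.range n) u c fun i hi => h i (Finset.mem_range.1 hi)

/-- A Banach space whose dual has the Banach-Saks property is reflexive. -/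
theorem HasBanachSaksProperty.isReflexiveSpace [CompleteSpace X]
    (h : HasBanachSaksProperty (StrongDual ℝ X)) : IsReflexiveSpace X := by
  by_contra hX
  obtain ⟨d, f, x, hd, hf, hx, hle, hsmall⟩ := exists_james_seq hX
  obtain ⟨φ, hφ, l, hl⟩ := h.exists_subseq hf
  have hlx : ∀ i, l (x i) ≤ d / 4 := by
    intro i
    -- the terms of the sequence beyond `i` are at most `d / 4` at `x i`
    have h1 : Tendsto (fun n => max (f (φ n) (x i) - d / 4) 0) atTop (𝓝 0) := by
      refine tendsto_const_nhds.congr' ?_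
      filter_upwards [eventually_gt_atTop i] with n hn
      exact (max_eq_right (by
        linarith [(abs_le.1 (hsmall i (φ n) (hn.trans_le (hφ.id_le n)))).2])).symm
    have h2 := (hl.apply (x i)).add_const (-(d / 4))
    have h3 : l (x i) + -(d / 4) ≤ 0 := by
      refine le_of_tendsto_of_tendsto' h2 h1.cesaro_smul fun n => ?_
      refine smul_le_smul_of_nonneg_left (Finset.sum_le_sum fun k _ => ?_) (by positivity)
      exact le_max_of_le_left (by rw [sub_eq_add_neg])
    linarith
  obtain ⟨n, hn, h0⟩ := ((Metric.tendsto_nhds.1 hl (d / 2) (half_pos hd)).and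
    (eventually_gt_atTop 0)).exists
  rw [dist_eq_norm] at hn
  set v := (n : ℝ)⁻¹ • ∑ i ∈ Finset.range n, f (φ i) with hv
  have h1 : d ≤ v (x (φ n)) := by
    have : v (x (φ n)) = (n : ℝ)⁻¹ * ∑ i ∈ Finset.range n, f (φ i) (x (φ n)) := by simp [hv]
    rw [this]
    exact le_inv_smul_sum_range h0 fun i hi => hle _ _ (hφ hi).le
  have h2 : |(v - l) (x (φ n))| ≤ d / 2 * 1 :=
    ((v - l).le_of_opNorm_le hn.le _).trans (by gcongr; exact hx _)
  rw [sub_apply] at h2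
  have := (abs_le.1 h2).2
  linarith [hlx (φ n)]

theorem HasBanachSaksProperty.hasPropertyMuS [CompleteSpace X]
    (h : HasBanachSaksProperty (StrongDual ℝ X)) : HasPropertyMuS X := by
  intro f hf
  rw [tendsto_toWeakDual_zero_iff] at hf
  obtain ⟨C, hC⟩ := banach_steinhaus (g := f) fun x => by
    obtain ⟨C, hC⟩ := (hf x).norm.bddAbove_range
    exact ⟨C, fun n => hC ⟨n, rfl⟩⟩
  obtain ⟨φ, hφ, hψ⟩ := h.exists_subseq_forall_cesaroTendsto hC fun φ hφ l hl => by
    ext x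
    exact (hl.apply x).eq_of_tendsto ((hf x).comp hφ.tendsto_atTop)
  exact ⟨φ, hφ, fun ψ h => (hψ ψ h).toMackeyDual⟩

theorem IsReflexiveSpace.hasBanachSaksProperty_strongDual [CompleteSpace X]
    (hX : IsReflexiveSpace X) (hμ : HasPropertyMuS X) :
    HasBanachSaksProperty (StrongDual ℝ X) := by
  intro u hu
  -- Rosenthal's theorem is applied in the dual, where only the evaluations at points of `X` are
  -- used.
  obtain ⟨φ, hφ, hlim⟩ := exists_weaklyCauchy_subseq hX.strongDual.not_isEllOneSeq (x := u)
    (C := 1) fun n => by simpa using hu n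
  choose l hl using fun x => hlim (NormedSpace.inclusionInDoubleDual ℝ X x)
  let f := continuousLinearMapOfTendsto (fun n => u (φ n)) (tendsto_pi_nhds.2 hl)
  obtain ⟨χ, hχ, hψ⟩ := hμ (fun n => u (φ n) - f) (tendsto_toWeakDual_zero_iff.2 fun x => by
    have := (hl x).sub_const (l x)
    rwa [sub_self] at this)
  refine ⟨φ ∘ χ, hφ.comp hχ, f, ?_⟩
  simpa using (hX.cesaroTendsto_of_toMackeyDual (hψ id strictMono_id)).add_const f

theorem HasPropertyMuS.isReflexiveSpace [CompleteSpace X] (hμ : HasPropertyMuS X)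
    (hX : ∀ y : ℕ → X, ¬ IsEllOneSeq y) : IsReflexiveSpace X := by
  by_contra hrefl
  obtain ⟨d, f, x, hd, hf, hx, hle, hsmall⟩ := exists_james_seq hrefl
  -- Both James estimates pass to convex combinations of late `f j`: these are at least `d` at all
  -- late `x i` and at most `d / 4` at each fixed earlier one.
  have hC : IsConvexNest fun n => convexHull ℝ (f '' Set.Ici n) :=
    ⟨fun n m hnm => convexHull_mono (Set.image_mono (Set.Ici_subset_Ici.2 hnm)),
      fun n => convex_convexHull ℝ _, fun n => (Set.nonempty_Ici.image f).convexHull,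
      fun n g hg => by
        have : g ∈ Metric.closedBall (0 : StrongDual ℝ X) 1 := by
          refine convexHull_min ?_ (convex_closedBall _ _) hg
          rintro _ ⟨j, -, rfl⟩
          simpa using hf j
        simpa using this⟩
  obtain ⟨h, hmem, hlim⟩ := hC.exists_tendsto hX
  choose l hl using hlim
  let h₀ := continuousLinearMapOfTendsto h (tendsto_pi_nhds.2 hl)
  have hh₀ : ∀ y, Tendsto (fun n => h n y) atTop (𝓝 (h₀ y)) := hl
  have hbig : ∀ n, ∃ I, ∀ i ≥ I, d ≤ h n (x i) := by
    intro n
    have : Convex ℝ {g : StrongDual ℝ X | ∃ I, ∀ i ≥ I, d ≤ g (x i)} := by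
      rintro g ⟨I, hI⟩ g' ⟨I', hI'⟩ a b ha hb hab
      refine ⟨max I I', fun i hi => ?_⟩
      have h1 := hI i ((le_max_left _ _).trans hi)
      have h2 := hI' i ((le_max_right _ _).trans hi)
      simp only [add_apply, smul_apply, smul_eq_mul]
      calc d = a * d + b * d := by rw [← add_mul, hab, one_mul]
        _ ≤ _ := by gcongr
    refine convexHull_min ?_ this (hmem n)
    rintro _ ⟨j, -, rfl⟩
    exact ⟨j, fun i hi => hle j i hi⟩
  have hh₀x : ∀ i, h₀ (x i) ≤ d / 4 := by
    intro i
    refine le_of_tendsto (hh₀ (x i)) ?_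
    filter_upwards [eventually_gt_atTop i] with n hn
    have : Convex ℝ {g : StrongDual ℝ X | g (x i) ≤ d / 4} :=
      convex_halfSpace_le ⟨fun _ _ => rfl, fun _ _ => rfl⟩ _
    refine convexHull_min ?_ this (hmem n)
    rintro _ ⟨j, hj, rfl⟩
    exact (abs_le.1 (hsmall i j (hn.trans_le hj))).2
  obtain ⟨φ, hφ, hψ⟩ := hμ (fun n => h n - h₀) (tendsto_toWeakDual_zero_iff.2 fun y => by
    have := (hh₀ y).sub_const (h₀ y)
    rwa [sub_self] at this)
  have hces := cesaroTendsto_toMackeyDual_iff.1 (hψ id strictMono_id)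
  set m : ℕ → StrongDual ℝ X := fun n =>
    (n : ℝ)⁻¹ • ∑ i ∈ Finset.range n, (h (φ (id i)) - h₀) with hm
  have hmapply : ∀ n y, m n y = (n : ℝ)⁻¹ * ∑ i ∈ Finset.range n, (h (φ i) y - h₀ y) := by
    intro n y
    simp [hm]
  have hmbig : ∀ n, 0 < n → ∃ I, ∀ i ≥ I, 3 * d / 4 ≤ m n (x i) := by
    intro n hn
    choose I hI using hbig
    refine ⟨(Finset.range n).sup fun k => I (φ k), fun i hi => ?_⟩
    rw [hmapply]
    refine le_inv_smul_sum_range hn fun k hk => ?_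
    have h1 := hI (φ k) i ((Finset.le_sup (f := fun k => I (φ k)) (Finset.mem_range.2 hk)).trans hi)
    have h2 := hh₀x i
    linarith
  have hmnull : ∀ y, Tendsto (fun n => m n y) atTop (𝓝 0) := by
    intro y
    have h1 : Tendsto (fun n => h (φ n) y - h₀ y) atTop (𝓝 0) := by
      have := ((hh₀ y).comp hφ.tendsto_atTop).sub_const (h₀ y)
      rwa [sub_self] at this
    exact h1.cesaro.congr fun n => (hmapply n y).symm
  obtain ⟨θ, hθ, hcauchy⟩ := exists_weaklyCauchy_subseq hX hx
  -- the differences `x (θ (F i)) - x (θ i)` are separated from `0` by the means `m (N i)`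
  have hN : ∀ i : ℕ, ∃ n ≥ i + 1, m n (x (θ i)) ≤ d / 4 := fun i => by
    have h1 : ∀ᶠ n in atTop, m n (x (θ i)) < d / 4 :=
      (hmnull (x (θ i))).eventually_lt_const (by positivity)
    obtain ⟨n, h2, h3⟩ := (h1.and (eventually_ge_atTop (i + 1))).exists
    exact ⟨n, h3, h2.le⟩
  choose N hNi hNd using hN
  have hF : ∀ i : ℕ, ∃ j > i, 3 * d / 4 ≤ m (N i) (x (θ j)) := fun i => by
    obtain ⟨I, hI⟩ := hmbig (N i) (by have := hNi i; omega)
    exact ⟨max I (i + 1), by omega, hI _ ((le_max_left _ _).trans (hθ.id_le _))⟩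
  choose F hFi hFd using hF
  -- Iterating `F` makes the pairs `(i, F i)` consecutive terms of one subsequence, so the
  -- differences are weakly null.
  let a : ℕ → ℕ := fun k => Nat.rec 0 (fun _ b => F b) k
  have ha : StrictMono a := strictMono_nat_of_lt_succ fun k => hFi (a k)
  have hK := insert_zero_range_mem_weaklyCompactSets
    (y := fun k => x (θ (a (k + 1))) - x (θ (a k))) fun g => by
      obtain ⟨l, hl⟩ := hcauchy g
      have h1 := hl.comp ha.tendsto_atTop
      have h2 := (h1.comp (tendsto_add_atTop_nat 1)).sub h1
      rw [sub_self] at h2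
      exact h2.congr fun k => by simp
  obtain ⟨n₀, hn₀⟩ := eventually_atTop.1 (hces _ hK (d / 2) (half_pos hd))
  -- Since `N i > i`, the mean of index `N (a n₀)` already obeys the uniform bound, yet it is at
  -- least `3 * d / 4 - d / 4` on this difference.
  have h1 := hn₀ (N (a n₀)) (by have := hNi (a n₀); have := ha.id_le n₀; simp at this; omega) _
    (Set.mem_insert_of_mem _ ⟨n₀, rfl⟩)
  have h2 := (abs_lt.1 h1).2
  have h3 := hFd (a n₀)
  have h4 := hNd (a n₀)
  change m (N (a n₀)) (x (θ (F (a n₀))) - x (θ (a n₀))) < d / 2 at h2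
  rw [map_sub] at h2
  linarith

end Main

theorem mainTheorem12 (X : Type*) [NormedAddCommGroup X] [NormedSpace ℝ X] [CompleteSpace X] :
    List.TFAE [HasBanachSaksProperty (StrongDual ℝ X),
      IsReflexiveSpace X ∧ HasPropertyMuS X,
      ¬ ContainsEllOne X ∧ HasPropertyMuS X] := by
  tfae_have 1 → 2 := fun h => ⟨h.isReflexiveSpace, h.hasPropertyMuS⟩
  tfae_have 2 → 3 := fun h => ⟨fun hX => by
    obtain ⟨x, hx⟩ := hX.exists_isEllOneSeq
    exact h.1.not_isEllOneSeq x hx, h.2⟩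
  tfae_have 3 → 2 := fun h =>
    ⟨h.2.isReflexiveSpace fun _ hy => h.1 hy.containsEllOne, h.2⟩
  tfae_have 2 → 1 := fun h => h.1.hasBanachSaksProperty_strongDual h.2
  tfae_finish
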